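/- Consider the square lattice $\mathbb{Z}^2$. An environment $\mathcal{G}=(\mathcal{G}_x)_{x\in\mathbb{Z}^2}$ assigns to each site $x$ a set $\mathcal{G}_x$ of available steps. Write $x\to y$ if there are $n\ge 0$ and sites $x=x_0,x_1,\dots,x_n=y$ with $x_{i+1}-x_i\in\mathcal{G}_{x_i}$ for $0\le i<n$, and let $\mathcal{M}_x=\{y : x\to y \text{ and } y\to x\}$. We say that $\mathcal{G}$ has a *gigantic $\mathcal{M}$-component* if there is a site $x$ such that $\mathcal{M}_x$ is infinite and every connected component of $\mathbb{Z}^2\setminus\mathcal{M}_x$ (with respect to nearest-neighbour adjacency) is finite. In the model $(\leftarrow\downarrow\rightarrow\;\uparrow)$ with parameter $p\in[0,1]$ the sets $\mathcal{G}_x$ are independent and, for each $x$, $\mathcal{G}_x=\{(-1,0),(0,-1),(1,0)\}$ with probability $p$ and $\mathcal{G}_x=\{(0,1)\}$ with probability $1-p$. In five-neighbour oriented site percolation with parameter $q\in[0,1]$ each site is open with probability $q$ and closed otherwise, independently. An open site $x$ is connected to the five sites $x+(-1,0)$, $x+(0,1)$, $x+(-1,1)$, $x+(0,-1)$, $x+(-1,-1)$;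 a closed site is connected to no neighbour. Let $p_c$ denote the infimum of those $q\in[0,1]$ for which, with positive probability, infinitely many sites can be reached from the origin. **Theorem.** If $p^3-p^2+2p-1>0$ and $p<1$, then almost surely the model $(\leftarrow\downarrow\rightarrow\;\uparrow)$ with parameter $p$ has a gigantic $\mathcal{M}$-component. Moreover, $p_c\ge 0.4311$. -/

import Mathlib

open MeasureTheory

namespace DRE

/-- An environment assigns to every site `x` of the square lattice the set `G x` of steps
available at `x`. It carries the product σ-algebra. -/
abbrev Env : Type := ℤ × ℤ → Set (ℤ × ℤ)

/-- `x` is connected to `y`: there is a finite (possibly empty) sequence of sites from `x` to `y`,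
each step of which is available at the site where it is taken. -/
def Connected (G : Env) (x y : ℤ × ℤ) : Prop :=
  Relation.ReflTransGen (fun u v : ℤ × ℤ => v - u ∈ G u) x y

/-- The set of sites that can be reached from `x`. -/
def forwardCluster (G : Env) (x : ℤ × ℤ) : Set (ℤ × ℤ) := {y | Connected G x y}

/-- The set of sites from which `y` can be reached. -/
def backwardCluster (G : Env) (y : ℤ × ℤ) : Set (ℤ × ℤ) := {x | Connected G x y}

/-- The set of sites that communicate with `x`. -/
def mutualCluster (G : Env) (x : ℤ × ℤ) : Set (ℤ × ℤ) :=
  backwardCluster G x ∩ forwardCluster G x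

/-- The four nearest-neighbour steps: right, up, left, down. -/
def unitSteps : Set (ℤ × ℤ) := {(1, 0), (0, 1), (-1, 0), (0, -1)}

/-- The undirected nearest-neighbour graph on the square lattice. -/
def lattice : SimpleGraph (ℤ × ℤ) where
  Adj x y := y - x ∈ unitSteps
  symm := ⟨by
    rintro ⟨a, b⟩ ⟨c, d⟩ h
    simp only [unitSteps, Set.mem_insert_iff, Set.mem_singleton_iff, Prod.mk_sub_mk,
      Prod.mk.injEq] at h ⊢
    omega⟩
  loopless := ⟨by
    rintro ⟨a, b⟩ h
    simp [unitSteps, Prod.ext_iff] at h⟩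

/-- The environment has a gigantic mutual component: some mutual cluster is infinite, and all
lattice-connected components of its complement are finite. -/
def HasGiganticComponent (G : Env) : Prop :=
  ∃ x : ℤ × ℤ, (mutualCluster G x).Infinite ∧
    ∀ K : (lattice.induce (mutualCluster G x)ᶜ).ConnectedComponent, K.supp.Finite

/-- The law on step sets that charges `A` with mass `p` and `B` with mass `1 - p`. -/
noncomputable def siteLaw (A B : Set (ℤ × ℤ)) (p : ℝ) : Measure (Set (ℤ × ℤ)) :=
  ENNReal.ofReal p • Measure.dirac A + ENNReal.ofReal (1 - p) • Measure.dirac B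

theorem isProbabilityMeasure_siteLaw (A B : Set (ℤ × ℤ)) {p : ℝ} (h0 : 0 ≤ p) (h1 : p ≤ 1) :
    IsProbabilityMeasure (siteLaw A B p) := by
  constructor
  simp only [siteLaw, Measure.add_apply, Measure.smul_apply, measure_univ, smul_eq_mul, mul_one]
  rw [← ENNReal.ofReal_add h0 (by linarith)]
  simp

/-- The law of the two-valued model `(A B)`: independently at every site, the set of available
steps is `A` with probability `p` and `B` with probability `1 - p` (for `0 ≤ p ≤ 1`). -/
noncomputable def envLaw (A B : Set (ℤ × ℤ)) (p : ℝ) : Measure Env :=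
  Measure.infinitePi (fun _ : ℤ × ℤ => siteLaw A B p)

theorem isProbabilityMeasure_envLaw (A B : Set (ℤ × ℤ)) {p : ℝ} (h0 : 0 ≤ p) (h1 : p ≤ 1) :
    IsProbabilityMeasure (envLaw A B p) := by
  have := isProbabilityMeasure_siteLaw A B h0 h1
  unfold envLaw
  infer_instance

/-- The steps left, down, right. -/
def stepsSWE : Set (ℤ × ℤ) := {(-1, 0), (0, -1), (1, 0)}

/-- The single step up. -/
def stepsUp : Set (ℤ × ℤ) := {(0, 1)}

/-- The five steps of an open vertex in five-neighbour oriented site percolation: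
W, N, NW, S, SW. -/
def stepsFSOSP : Set (ℤ × ℤ) := {(-1, 0), (0, 1), (-1, 1), (0, -1), (-1, -1)}

/-- The critical value of five-neighbour oriented site percolation, in which each site is open with
probability `q`, open sites lead to their five neighbours, and closed sites lead nowhere: the
infimum of the `q` for which the cluster of the origin is infinite with positive probability. -/
noncomputable def criticalFSOSP : ℝ :=
  sInf {q : ℝ | 0 ≤ q ∧ q ≤ 1 ∧
    0 < envLaw stepsFSOSP ∅ q {G | (forwardCluster G (0, 0)).Infinite}}

end DRE

/-! Note that p^3 - p^2 + 2p - 1 = p^3 - (1-p)^2. In the model, a path may enter a column and leave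
it as low as possible: from a site of type `stepsSWE` it descends to just above the first `stepsUp`
site, from a `stepsUp` site it is forced up to the first `stepsSWE` site. With q = 1 - p, the exit
level minus the entry level has mean q/p - p^2/q, which is negative exactly when q^2 < p^3. Each new
column contains fresh sites, so a Chernoff bound (`StepFamily.measure_reach_le`) and Borel-Cantelli
show that low paths tend to minus infinity in both horizontal directions.

The rest of the first claim is planar topology. If w is missed by the forward cluster of z, this
cluster contains sites above and below w in its column. Low paths from the upper site fall on both
sides, first-exit paths from the lower site never fall, so the curves enclose a finite region
containing w (`exists_finite_region`). Hence the components of the complement of a forward cluster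
are finite. A site x with infinite backward cluster is then reachable from everywhere: if z misses
x, the backward cluster of x avoids the forward cluster of z and is trapped in the finite region. So
the mutual cluster of x is its forward cluster. Such an x is found by sending a sequence of longer
and longer gates on the vertical axis back to lower gates (`ae_exists_infinite_backwardCluster`).

For the percolation bound, the cluster is reflected so that it grows to the right, and an upper
bound for the levels at which it enters each column is followed. The displacement of this bound has
the same law as above, with open sites of probability q in the role of `stepsUp`; negative drift
would give q^2 < p^3, only slightly weaker than 0.4311. The gain comes from an isolated site: if
three sites below the highest open site are closed, a certain level of the next column cannot be
entered, and if the open site there has closed vertical neighbours it is not reached, so the bound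
drops by 4 instead of 2. A two-state exploration (`refinedFamily`) records this. Below 0.4311 its
drift is negative, so the upper edge falls below 0, by reflection the lower edge rises above 0, and
the cluster is finite. -/

namespace DRE

/-! ### Cylinder bounds for independent sites -/

/-- Two families of events indexed by the lattice behave like the open and closed sites of
Bernoulli site percolation, at least as far as upper bounds on cylinder events are concerned. -/
def IsSiteField {Ω : Type*} [MeasurableSpace Ω] (μ : Measure Ω) (o c : ℤ × ℤ → Set Ω)
    (q p : ENNReal) : Prop :=
  ∀ O C : Finset (ℤ × ℤ), Disjoint O C →
    μ {ω | (∀ z ∈ O, ω ∈ o z) ∧ ∀ z ∈ C, ω ∈ c z} ≤ q ^ O.card * p ^ C.card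

theorem siteLaw_singleton_left {A B : Set (ℤ × ℤ)} (h : A ≠ B) (p : ℝ) :
    siteLaw A B p {A} = ENNReal.ofReal p := by
  simp [siteLaw, h.symm]

theorem siteLaw_singleton_right {A B : Set (ℤ × ℤ)} (h : A ≠ B) (p : ℝ) :
    siteLaw A B p {B} = ENNReal.ofReal (1 - p) := by
  simp [siteLaw, h]

theorem isSiteField_envLaw {A B : Set (ℤ × ℤ)} (h : A ≠ B) {p : ℝ} (h0 : 0 ≤ p) (h1 : p ≤ 1) :
    IsSiteField (envLaw A B p) (fun z => {G | G z = A}) (fun z => {G | G z = B})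
      (ENNReal.ofReal p) (ENNReal.ofReal (1 - p)) := by
  intro O C hOC
  have := isProbabilityMeasure_siteLaw A B h0 h1
  classical
  have hset : {G : Env | (∀ z ∈ O, G ∈ {G : Env | G z = A}) ∧ ∀ z ∈ C, G ∈ {G : Env | G z = B}} =
      ((↑(O ∪ C) : Set (ℤ × ℤ)).pi fun z => if z ∈ O then {A} else {B}) := by
    ext G
    simp only [Set.mem_ofPred_eq, Set.mem_pi, Finset.coe_union, Set.mem_union, Finset.mem_coe]
    constructor
    · rintro ⟨hO, hC⟩ z hz
      by_cases hzO : z ∈ O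
      · simpa [hzO] using hO z hzO
      · simpa [hzO] using hC z (hz.resolve_left hzO)
    · intro hG
      refine ⟨fun z hz => by simpa [hz] using hG z (Or.inl hz), fun z hz => ?_⟩
      have hzO : z ∉ O := fun h' => Finset.disjoint_left.1 hOC h' hz
      simpa [hzO] using hG z (Or.inr hz)
  rw [hset, envLaw, Measure.infinitePi_pi _ (fun i _ => by split_ifs <;> exact measurableSet_singleton _),
    Finset.prod_union hOC]
  refine le_of_eq ?_
  congr 1
  · rw [Finset.prod_congr rfl (g := fun _ => ENNReal.ofReal p), Finset.prod_const]
    intro z hz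
    simp only [hz, if_true]
    exact siteLaw_singleton_left h p
  · rw [Finset.prod_congr rfl (g := fun _ => ENNReal.ofReal (1 - p)), Finset.prod_const]
    intro z hz
    have hzO : z ∉ O := fun h' => Finset.disjoint_left.1 hOC h' hz
    simp only [hzO, if_false]
    exact siteLaw_singleton_right h p

theorem ae_envLaw_mem {A B : Set (ℤ × ℤ)} {p : ℝ} (h0 : 0 ≤ p) (h1 : p ≤ 1) :
    ∀ᵐ G ∂(envLaw A B p), ∀ z, G z = A ∨ G z = B := by
  have := isProbabilityMeasure_siteLaw A B h0 h1
  rw [ae_all_iff]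
  intro z
  have h : Measure.map (fun G : Env => G z) (envLaw A B p) = siteLaw A B p :=
    (measurePreserving_eval_infinitePi (fun _ : ℤ × ℤ => siteLaw A B p) z).map_eq
  have h' : ∀ᵐ S ∂(siteLaw A B p), S = A ∨ S = B := by
    rw [ae_iff]
    have hm : MeasurableSet {a | ¬(a = A ∨ a = B)} := by
      have : {a | ¬(a = A ∨ a = B)} = ({A, B} : Set (Set (ℤ × ℤ)))ᶜ := by ext; simp
      rw [this]
      exact (Set.toFinite _).measurableSet.compl
    simp [siteLaw]
  rw [← h] at h'
  exact ae_of_ae_map (measurable_pi_apply z).aemeasurable h'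

namespace IsSiteField

variable {Ω : Type*} [MeasurableSpace Ω] {μ : Measure Ω} {o c : ℤ × ℤ → Set Ω} {q p : ENNReal}

theorem comp (H : IsSiteField μ o c q p) {e : ℤ × ℤ → ℤ × ℤ} (he : Function.Injective e) :
    IsSiteField μ (fun z => o (e z)) (fun z => c (e z)) q p := by
  intro O C hOC
  have := H (O.map ⟨e, he⟩) (C.map ⟨e, he⟩) ((Finset.disjoint_map _).2 hOC)
  simpa only [Finset.forall_mem_map, Finset.card_map, Function.Embedding.coeFn_mk] using this

theorem swap (H : IsSiteField μ o c q p) : IsSiteField μ c o p q := by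
  intro O C hOC
  have := H C O hOC.symm
  rw [mul_comm]
  convert this using 4
  exact and_comm

/-- Along an injective sequence of sites, some site is not closed. -/
theorem ae_exists_notMem (H : IsSiteField μ o c q p) (hp : p < 1) {f : ℕ → ℤ × ℤ}
    (hf : Function.Injective f) : ∀ᵐ ω ∂μ, ∃ n, ω ∉ c (f n) := by
  rw [ae_iff]
  have hle : ∀ n : ℕ, μ {ω | ¬ ∃ n, ω ∉ c (f n)} ≤ p ^ n := by
    intro n
    have := H ∅ ((Finset.range n).map ⟨f, hf⟩) (by simp)
    simp only [Finset.card_map, Finset.card_range, Finset.card_empty, pow_zero, one_mul] at this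
    refine (measure_mono ?_).trans this
    intro ω hω
    simp only [Set.mem_ofPred_eq, not_exists, not_not] at hω
    simp [hω]
  exact le_antisymm (ge_of_tendsto' (ENNReal.tendsto_pow_atTop_nhds_zero_of_lt_one hp) hle) bot_le

end IsSiteField

/-! ### Column-by-column exploration and its exponential moments -/

/-- A family of local events, each determined by the state of finitely many sites of a column, and
accompanied by a vertical displacement and by a new internal state. -/
structure StepFamily (S ι : Type*) where
  opn : ι → ℤ → ℤ → Finset (ℤ × ℤ)
  cls : ι → ℤ → ℤ → Finset (ℤ × ℤ)
  disp : ι → ℤ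
  next : ι → S
  numOpn : ι → ℕ
  numCls : ι → ℕ
  card_opn : ∀ i x h, (opn i x h).card = numOpn i
  card_cls : ∀ i x h, (cls i x h).card = numCls i
  disjoint : ∀ i x h, Disjoint (opn i x h) (cls i x h)
  mem_opn : ∀ i x h, ∀ z ∈ opn i x h, z.1 = x
  mem_cls : ∀ i x h, ∀ z ∈ cls i x h, z.1 = x

namespace StepFamily

variable {S Ω : Type*} {ι : S → Type*}

/-- The local event with index `i`, placed at column `x` and level `h`, occurs. -/
def Occurs {κ : Type*} (F : StepFamily S κ) (o c : ℤ × ℤ → Set Ω) (i : κ) (x h : ℤ) (ω : Ω) :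
    Prop :=
  (∀ z ∈ F.opn i x h, ω ∈ o z) ∧ ∀ z ∈ F.cls i x h, ω ∈ c z

/-- Some chain of `n` successive local events leads from state `s`, column `x` and level `h` to a
level satisfying `Q`. -/
def Reach (F : ∀ s, StepFamily S (ι s)) (o c : ℤ × ℤ → Set Ω) (Q : ℤ → Prop) :
    ℕ → S → ℤ → ℤ → Ω → Prop
  | 0, _, _, h, _ => Q h
  | n + 1, s, x, h, ω => ∃ i, (F s).Occurs o c i x h ω ∧
      Reach F o c Q n ((F s).next i) (x + 1) (h + (F s).disp i) ω

variable [MeasurableSpace Ω] [∀ s, Countable (ι s)] {μ : Measure Ω} {o c : ℤ × ℤ → Set Ω}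

/-- The sets `O` and `C` record what has been revealed in earlier columns. A step adds sites of
column `x` only, so they remain disjoint and the weights multiply; a union bound over the indices
then replaces independence, and no measurability of `Reach` is needed. The function `f` is a
supermartingale up to the factor `M`. -/
theorem measure_inter_reach_le (F : ∀ s, StepFamily S (ι s)) {q p : ENNReal}
    (H : IsSiteField μ o c q p) {Q : ℤ → Prop} {f : S → ℤ → ENNReal} {M : ENNReal}
    (hQ : ∀ s h, Q h → 1 ≤ f s h)
    (hM : ∀ s h, ∑' i, q ^ (F s).numOpn i * p ^ (F s).numCls i *
      f ((F s).next i) (h + (F s).disp i) ≤ M * f s h) (n : ℕ) :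
    ∀ (s : S) (x h : ℤ) (O C : Finset (ℤ × ℤ)), Disjoint O C → (∀ z ∈ O, z.1 < x) →
      (∀ z ∈ C, z.1 < x) →
      μ {ω | ((∀ z ∈ O, ω ∈ o z) ∧ ∀ z ∈ C, ω ∈ c z) ∧ Reach F o c Q n s x h ω} ≤
        q ^ O.card * p ^ C.card * (M ^ n * f s h) := by
  induction n with
  | zero =>
    intro s x h O C hOC _ _
    by_cases hh : Q h
    · calc _ ≤ μ {ω | (∀ z ∈ O, ω ∈ o z) ∧ ∀ z ∈ C, ω ∈ c z} := measure_mono fun ω hω => hω.1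
        _ ≤ q ^ O.card * p ^ C.card := H O C hOC
        _ ≤ _ := le_mul_of_one_le_right bot_le (by simpa using hQ s h hh)
    · simp [Reach, hh]
  | succ n ih =>
    intro s x h O C hOC hO hC
    classical
    have hdO : ∀ i, Disjoint O ((F s).opn i x h) := fun i =>
      Finset.disjoint_left.2 fun z hz hz' => (hO z hz).ne ((F s).mem_opn i x h z hz')
    have hdC : ∀ i, Disjoint C ((F s).cls i x h) := fun i =>
      Finset.disjoint_left.2 fun z hz hz' => (hC z hz).ne ((F s).mem_cls i x h z hz')
    have hd : ∀ i, Disjoint (O ∪ (F s).opn i x h) (C ∪ (F s).cls i x h) := fun i => by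
      rw [Finset.disjoint_union_left, Finset.disjoint_union_right, Finset.disjoint_union_right]
      exact ⟨⟨hOC, Finset.disjoint_left.2 fun z hz hz' =>
        (hO z hz).ne ((F s).mem_cls i x h z hz')⟩, Finset.disjoint_left.2 fun z hz hz' =>
        (hC z hz').ne ((F s).mem_opn i x h z hz), (F s).disjoint i x h⟩
    calc _ ≤ μ (⋃ i, {ω | ((∀ z ∈ O ∪ (F s).opn i x h, ω ∈ o z) ∧
            ∀ z ∈ C ∪ (F s).cls i x h, ω ∈ c z) ∧
            Reach F o c Q n ((F s).next i) (x + 1) (h + (F s).disp i) ω}) := by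
          refine measure_mono ?_
          rintro ω ⟨⟨h1, h2⟩, i, ⟨h3, h4⟩, h5⟩
          refine Set.mem_iUnion.2 ⟨i, ⟨fun z hz => ?_, fun z hz => ?_⟩, h5⟩
          · exact (Finset.mem_union.1 hz).elim (h1 z) (h3 z)
          · exact (Finset.mem_union.1 hz).elim (h2 z) (h4 z)
      _ ≤ ∑' i, μ {ω | ((∀ z ∈ O ∪ (F s).opn i x h, ω ∈ o z) ∧
            ∀ z ∈ C ∪ (F s).cls i x h, ω ∈ c z) ∧
            Reach F o c Q n ((F s).next i) (x + 1) (h + (F s).disp i) ω} := measure_iUnion_le _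
      _ ≤ ∑' i, q ^ O.card * p ^ C.card * M ^ n * (q ^ (F s).numOpn i * p ^ (F s).numCls i *
            f ((F s).next i) (h + (F s).disp i)) := by
          refine ENNReal.tsum_le_tsum fun i => ?_
          refine (ih _ (x + 1) (h + (F s).disp i) _ _ (hd i) ?_ ?_).trans (le_of_eq ?_)
          · intro z hz
            rcases Finset.mem_union.1 hz with hz | hz
            · exact (hO z hz).trans (lt_add_one x)
            · exact ((F s).mem_opn i x h z hz).trans_lt (lt_add_one x)
          · intro z hz
            rcases Finset.mem_union.1 hz with hz | hz
            · exact (hC z hz).trans (lt_add_one x)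
            · exact ((F s).mem_cls i x h z hz).trans_lt (lt_add_one x)
          · rw [Finset.card_union_of_disjoint (hdO i), Finset.card_union_of_disjoint (hdC i),
              (F s).card_opn, (F s).card_cls, pow_add, pow_add]
            ring
      _ = q ^ O.card * p ^ C.card * M ^ n * ∑' i, q ^ (F s).numOpn i * p ^ (F s).numCls i *
            f ((F s).next i) (h + (F s).disp i) := ENNReal.tsum_mul_left
      _ ≤ q ^ O.card * p ^ C.card * M ^ n * (M * f s h) := by gcongr; exact hM s h
      _ = _ := by ring

/-- The exponential moment bound: if, for every internal state `s`, the total weight of the local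
events, weighted by `t` to the displacement and by the factor `κ` of the new state, is at most
`M * κ s`, then the probability of reaching in `n` steps a level satisfying `Q` is at most
`M ^ n * (κ s * t ^ (h - m))`. -/
theorem measure_reach_le (F : ∀ s, StepFamily S (ι s)) {q p t M : ℝ} (hq : 0 ≤ q) (hp : 0 ≤ p)
    (ht : 0 < t) (hM : 0 ≤ M) (H : IsSiteField μ o c (ENNReal.ofReal q) (ENNReal.ofReal p))
    {κ T : S → ℝ} (hκ : ∀ s, 0 ≤ κ s)
    (hsum : ∀ s, HasSum (fun i => q ^ (F s).numOpn i * p ^ (F s).numCls i * t ^ (F s).disp i *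
      κ ((F s).next i)) (T s)) (hT : ∀ s, T s ≤ M * κ s)
    {Q : ℤ → Prop} (m : ℤ) (hQ : ∀ s h, Q h → 1 ≤ κ s * t ^ (h - m)) (n : ℕ) (s : S) (x h : ℤ) :
    μ {ω | Reach F o c Q n s x h ω} ≤ ENNReal.ofReal (M ^ n * (κ s * t ^ (h - m))) := by
  have hnn : ∀ s i, 0 ≤ q ^ (F s).numOpn i * p ^ (F s).numCls i * t ^ (F s).disp i *
      κ ((F s).next i) := fun s i => mul_nonneg (by positivity) (hκ _)
  rw [ENNReal.ofReal_mul (by positivity), ENNReal.ofReal_pow hM]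
  have key := measure_inter_reach_le F H (Q := Q) (M := ENNReal.ofReal M)
    (f := fun s h => ENNReal.ofReal (κ s * t ^ (h - m))) (fun s h hh => by simpa using hQ s h hh)
    ?_ n s x h ∅ ∅ (by simp) (by simp) (by simp)
  · simpa using key
  · intro s h
    have : ∀ i, ENNReal.ofReal q ^ (F s).numOpn i * ENNReal.ofReal p ^ (F s).numCls i *
        ENNReal.ofReal (κ ((F s).next i) * t ^ (h + (F s).disp i - m)) =
        ENNReal.ofReal (q ^ (F s).numOpn i * p ^ (F s).numCls i * t ^ (F s).disp i *
          κ ((F s).next i)) * ENNReal.ofReal (t ^ (h - m)) := by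
      intro i
      rw [← ENNReal.ofReal_pow hq, ← ENNReal.ofReal_pow hp, ← ENNReal.ofReal_mul (by positivity),
        ← ENNReal.ofReal_mul (by positivity), ← ENNReal.ofReal_mul (hnn s i),
        show h + (F s).disp i - m = (F s).disp i + (h - m) by ring, zpow_add₀ ht.ne']
      ring_nf
    simp_rw [this]
    rw [ENNReal.tsum_mul_right, ← ENNReal.ofReal_tsum_of_nonneg (hnn s) (hsum s).summable,
      (hsum s).tsum_eq, ENNReal.ofReal_mul (hκ s), ← mul_assoc, ← ENNReal.ofReal_mul hM]
    gcongr
    exact hT s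

end StepFamily
-- The one-state edge process and its drift
/-- The sites `(x, a), …, (x, b)`. -/
noncomputable def vseg (x a b : ℤ) : Finset (ℤ × ℤ) := {x} ×ˢ Finset.Icc a b

@[simp] theorem mem_vseg {x a b : ℤ} {z : ℤ × ℤ} : z ∈ vseg x a b ↔ z.1 = x ∧ a ≤ z.2 ∧ z.2 ≤ b := by
  rw [vseg, Finset.mem_product, Finset.mem_singleton, Finset.mem_Icc]

@[simp] theorem card_vseg (x a b : ℤ) : (vseg x a b).card = (b + 1 - a).toNat := by
  simp [vseg]

/-- The local events that determine the highest open site accessible from level `h` in a column: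
either `h, …, h + j` are open and `h + j + 1` is closed, or `h - j, …, h` are closed and
`h - j - 1` is open. The displacement leads to the level just above that open site. -/
noncomputable def edgeFamily (_ : Unit) : StepFamily Unit (ℕ ⊕ ℕ) where
  opn i x h := match i with
    | .inl j => vseg x h (h + j)
    | .inr j => {(x, h - j - 1)}
  cls i x h := match i with
    | .inl j => {(x, h + j + 1)}
    | .inr j => vseg x (h - j) h
  disp i := match i with
    | .inl j => j + 1
    | .inr j => -j
  next _ := ()
  numOpn i := match i with
    | .inl j => j + 1
    | .inr _ => 1
  numCls i := match i with
    | .inl _ => 1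
    | .inr j => j + 1
  card_opn i x h := by cases i <;> simp; omega
  card_cls i x h := by cases i <;> simp; omega
  disjoint i x h := by
    cases i <;> simp
  mem_opn i x h z hz := by
    cases i <;> simp [Prod.ext_iff] at hz <;> omega
  mem_cls i x h z hz := by
    cases i <;> simp [Prod.ext_iff] at hz <;> omega

theorem hasSum_up {p q t : ℝ} (hq : 0 ≤ q) (ht : 0 < t) (hqt : q * t < 1) :
    HasSum (fun j : ℕ => q ^ (j + 1) * p ^ 1 * t ^ ((j : ℤ) + 1)) (p * q * t / (1 - q * t)) := by
  have := (hasSum_geometric_of_lt_one (by positivity) hqt).mul_left (p * q * t)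
  rw [div_eq_mul_inv]
  refine this.congr_fun fun j => ?_
  rw [zpow_add₀ ht.ne', zpow_natCast, zpow_one, mul_pow]
  ring

theorem hasSum_down {p q t : ℝ} (hp : 0 ≤ p) (ht : 0 < t) (hpt : p < t) :
    HasSum (fun j : ℕ => q ^ 1 * p ^ (j + 1) * t ^ (-(j : ℤ))) (p * q * t / (t - p)) := by
  have := (hasSum_geometric_of_lt_one (r := p / t) (by positivity)
    ((div_lt_one ht).2 hpt)).mul_left (p * q)
  have h' : t - p ≠ 0 := by linarith
  have h2 : p * q * t / (t - p) = p * q * (1 - p / t)⁻¹ := by field_simp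
  rw [h2]
  refine this.congr_fun fun j => ?_
  rw [zpow_neg, zpow_natCast, div_pow]
  ring

theorem measure_reach_edgeFamily_le {Ω : Type*} [MeasurableSpace Ω] {μ : Measure Ω}
    {o c : ℤ × ℤ → Set Ω} {p q t : ℝ} (hp : 0 ≤ p) (hq : 0 ≤ q) (ht : 0 < t) (hqt : q * t < 1)
    (hpt : p < t) (H : IsSiteField μ o c (ENNReal.ofReal q) (ENNReal.ofReal p)) {Q : ℤ → Prop}
    (m : ℤ) (hQ : ∀ h, Q h → 1 ≤ t ^ (h - m)) (n : ℕ) (x h : ℤ) :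
    μ {ω | StepFamily.Reach edgeFamily o c Q n () x h ω} ≤ ENNReal.ofReal
      ((p * q * t / (1 - q * t) + p * q * t / (t - p)) ^ n * t ^ (h - m)) := by
  have h1 : 0 < 1 - q * t := by linarith
  have h2 : 0 < t - p := by linarith
  have := StepFamily.measure_reach_le edgeFamily hq hp ht
    (M := p * q * t / (1 - q * t) + p * q * t / (t - p)) (by positivity) H (κ := fun _ => 1)
    (T := fun _ => p * q * t / (1 - q * t) + p * q * t / (t - p)) (fun _ => zero_le_one)
    (fun _ => HasSum.sum ((hasSum_up hq ht hqt).congr_fun fun _ => mul_one _)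
      ((hasSum_down hp ht hpt).congr_fun fun _ => mul_one _)) (fun _ => (mul_one _).ge) m
    (fun _ h hh => by simpa using hQ h hh) n () x h
  simpa using this

/-- A function with negative derivative falls below its initial value immediately to the right. -/
theorem exists_gt_lt_of_hasDerivAt_neg {f : ℝ → ℝ} {f' a b : ℝ} (hf : HasDerivAt f f' a)
    (h : f' < 0) (hab : a < b) : ∃ t, a < t ∧ t < b ∧ f t < f a := by
  have h1 := (hasDerivAt_iff_tendsto_slope.1 hf).eventually_lt_const h
  have h2 : ∀ᶠ t in nhdsWithin a (Set.Ioi a), slope f a t < 0 :=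
    h1.filter_mono (nhdsWithin_mono _ fun t ht => ne_of_gt ht)
  obtain ⟨t, ht, ht2⟩ := (h2.and (Ioo_mem_nhdsGT hab)).exists
  refine ⟨t, ht2.1, ht2.2, ?_⟩
  rw [slope_def_field, div_neg_iff] at ht
  rcases ht with ht | ht
  · linarith [ht.2, ht2.1]
  · linarith [ht.1]

theorem hasDerivAt_up {p q : ℝ} (hp : p = 1 - q) (hp0 : p ≠ 0) :
    HasDerivAt (fun t : ℝ => p * q * t / (1 - q * t)) (q / p) 1 := by
  have h1 : HasDerivAt (fun t : ℝ => p * q * t) (p * q * 1) 1 := (hasDerivAt_id' _).const_mul _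
  have h2 : HasDerivAt (fun t : ℝ => 1 - q * t) (-(q * 1)) 1 :=
    ((hasDerivAt_id' _).const_mul _).const_sub _
  have h3 : 1 - q * 1 = p := by rw [hp]; ring
  refine (h1.div h2 (by rw [h3]; exact hp0)).congr_deriv ?_
  rw [h3, div_eq_div_iff (pow_ne_zero _ hp0) hp0, hp]
  ring

theorem hasDerivAt_down {p q : ℝ} (hp : p = 1 - q) (hq0 : q ≠ 0) :
    HasDerivAt (fun t : ℝ => p * q * t / (t - p)) (-(p ^ 2 / q)) 1 := by
  have h1 : HasDerivAt (fun t : ℝ => p * q * t) (p * q * 1) 1 := (hasDerivAt_id' _).const_mul _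
  have h2 : HasDerivAt (fun t : ℝ => t - p) 1 1 := (hasDerivAt_id' _).sub_const _
  have h3 : 1 - p = q := by rw [hp]; ring
  refine (h1.div h2 (by rw [h3]; exact hq0)).congr_deriv ?_
  rw [h3, ← neg_div, div_eq_div_iff (pow_ne_zero _ hq0) hq0, hp]
  ring

/-- If the drift `q / p - p ^ 2 / q` is negative, then some exponential moment of the displacement
is smaller than one. -/
theorem exists_edge_moment_lt_one {p q : ℝ} (hpq : p = 1 - q) (hp : 0 < p) (hq : 0 < q)
    (h : q ^ 2 < p ^ 3) :
    ∃ t, 1 < t ∧ q * t < 1 ∧ p * q * t / (1 - q * t) + p * q * t / (t - p) < 1 := by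
  -- At t = 1 the moment equals q + p = 1 and its derivative is the drift, so it dips below 1 just
  -- to the right of 1.
  have hd := (hasDerivAt_up hpq hp.ne').add (hasDerivAt_down hpq hq.ne')
  have hneg : q / p + -(p ^ 2 / q) < 0 := by
    rw [← sub_eq_add_neg, sub_neg, div_lt_div_iff₀ hp hq]
    nlinarith
  have hq1 : q < 1 := by linarith
  obtain ⟨t, h1, h2, h3⟩ := exists_gt_lt_of_hasDerivAt_neg hd hneg
    (show (1 : ℝ) < 1 / q from by rw [lt_div_iff₀ hq]; linarith)
  refine ⟨t, h1, ?_, h3.trans_le (le_of_eq ?_)⟩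
  · rw [lt_div_iff₀ hq] at h2
    linarith
  · have e1 : 1 - q * 1 = p := by rw [hpq]; ring
    have e2 : 1 - p = q := by rw [hpq]; ring
    simp only [Pi.add_apply]
    rw [e1, e2]
    field_simp
    linarith
-- Paths in a fixed environment
theorem stepsSWE_ne_stepsUp : stepsSWE ≠ stepsUp := by
  intro h
  have : ((0, 1) : ℤ × ℤ) ∈ stepsSWE := h ▸ rfl
  simp [stepsSWE] at this

theorem Connected.refl (G : Env) (x : ℤ × ℤ) : Connected G x x := Relation.ReflTransGen.refl

theorem Connected.trans {G : Env} {x y z : ℤ × ℤ} (h : Connected G x y) (h' : Connected G y z) :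
    Connected G x z := Relation.ReflTransGen.trans h h'

theorem connected_step {G : Env} {x y : ℤ × ℤ} (h : y - x ∈ G x) : Connected G x y :=
  Relation.ReflTransGen.single h

/-- Every site has one of the two step sets of the model, and both kinds of sites recur in every
column and to the left in every row. -/
structure IsMixed (G : Env) : Prop where
  mem : ∀ z, G z = stepsSWE ∨ G z = stepsUp
  swe_above : ∀ x h, ∃ y, h ≤ y ∧ G (x, y) = stepsSWE
  up_below : ∀ x h, ∃ y, y ≤ h ∧ G (x, y) = stepsUp
  up_left : ∀ x h, ∃ n : ℕ, G (x - n, h) = stepsUp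

variable {G : Env}

theorem connected_up {x y : ℤ} (h : G (x, y) = stepsUp) : Connected G (x, y) (x, y + 1) :=
  connected_step (by simp [h, stepsUp])

theorem connected_down {x y : ℤ} (h : G (x, y) = stepsSWE) : Connected G (x, y) (x, y - 1) :=
  connected_step (by simp [h, stepsSWE])

theorem connected_side {σ x y : ℤ} (hσ : σ = 1 ∨ σ = -1) (h : G (x, y) = stepsSWE) :
    Connected G (x, y) (x + σ, y) :=
  connected_step (by rcases hσ with rfl | rfl <;> simp [h, stepsSWE])

theorem connected_up_run {x h : ℤ} (n : ℕ) (hN : ∀ y, h ≤ y → y < h + n → G (x, y) = stepsUp) :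
    Connected G (x, h) (x, h + n) := by
  induction n with
  | zero => simpa using Connected.refl G _
  | succ n ih =>
    have h1 := ih fun y hy hy' => hN y hy (by push_cast; omega)
    have h2 := connected_up (hN (h + n) (by omega) (by push_cast; omega))
    push_cast
    rw [← add_assoc]
    exact h1.trans h2

theorem connected_down_run {x h : ℤ} (n : ℕ) (hS : ∀ y, h - n < y → y ≤ h → G (x, y) = stepsSWE) :
    Connected G (x, h) (x, h - n) := by
  induction n with
  | zero => simpa using Connected.refl G _
  | succ n ih =>
    have h1 := ih fun y hy hy' => hS y (by push_cast; omega) hy'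
    have h2 := connected_down (hS (h - n) (by push_cast; omega) (by omega))
    push_cast
    rw [← sub_sub]
    exact h1.trans h2

/-- `h'` is the level at which the lowest path entering column `x` at level `h` leaves it. -/
def LowExit (G : Env) (x h h' : ℤ) : Prop :=
  G (x, h') = stepsSWE ∧ G (x, h' - 1) = stepsUp ∧
    (∀ y, h' ≤ y → y ≤ h → G (x, y) = stepsSWE) ∧ ∀ y, h ≤ y → y < h' → G (x, y) = stepsUp

/-- `h'` is the first level at which a path entering column `x` at level `h` can leave it. -/
def FirstExit (G : Env) (x h h' : ℤ) : Prop :=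
  G (x, h') = stepsSWE ∧ h ≤ h' ∧ ∀ y, h ≤ y → y < h' → G (x, y) = stepsUp

theorem IsMixed.exists_firstExit (hG : IsMixed G) (x h : ℤ) : ∃ h', FirstExit G x h h' := by
  obtain ⟨y, hy, hmin⟩ := Int.exists_least_of_bdd (P := fun y => h ≤ y ∧ G (x, y) = stepsSWE)
    ⟨h, fun z hz => hz.1⟩ (hG.swe_above x h)
  refine ⟨y, hy.2, hy.1, fun z hz hzy => (hG.mem _).resolve_left fun hs => ?_⟩
  exact absurd (hmin z ⟨hz, hs⟩) (by omega)

theorem IsMixed.exists_lowExit (hG : IsMixed G) (x h : ℤ) : ∃ h', LowExit G x h h' := by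
  rcases hG.mem (x, h) with hs | hu
  · obtain ⟨y, hy, hmax⟩ := Int.exists_greatest_of_bdd (P := fun y => y ≤ h ∧ G (x, y) = stepsUp)
      ⟨h, fun z hz => hz.1⟩ (hG.up_below x h)
    have hS : ∀ z, y + 1 ≤ z → z ≤ h → G (x, z) = stepsSWE := fun z hz hzh =>
      (hG.mem _).resolve_right fun hu => absurd (hmax z ⟨hzh, hu⟩) (by omega)
    have hyh : y ≠ h := by
      rintro rfl
      exact stepsSWE_ne_stepsUp (hs.symm.trans hy.2)
    have := hy.1
    refine ⟨y + 1, hS _ le_rfl (by omega), by simpa using hy.2, hS, fun z hz hz' => by omega⟩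
  · obtain ⟨y, h1, h2, h3⟩ := hG.exists_firstExit x h
    have hyh : y ≠ h := by
      rintro rfl
      exact stepsSWE_ne_stepsUp (h1.symm.trans hu)
    exact ⟨y, h1, h3 _ (by omega) (by omega), fun z hz hz' => by omega, h3⟩

/-- Low paths cannot cross: the exit of one would otherwise be of the wrong type for the other.
Hence controlling extreme starting levels controls all levels between them. -/
theorem LowExit.mono {x h₁ h₂ k₁ k₂ : ℤ} (H₁ : LowExit G x h₁ k₁) (H₂ : LowExit G x h₂ k₂)
    (h : h₁ ≤ h₂) : k₁ ≤ k₂ := by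
  have hne : ∀ {y}, G (x, y) = stepsSWE → G (x, y) = stepsUp → False :=
    fun hs hu => stepsSWE_ne_stepsUp (hs.symm.trans hu)
  by_contra! hlt
  rcases le_or_gt k₁ h₁ with hk | hk
  · exact hne (H₂.2.2.1 (k₁ - 1) (by omega) (by omega)) H₁.2.1
  · rcases le_or_gt h₁ k₂ with hk' | hk'
    · exact hne H₂.1 (H₁.2.2.2 k₂ hk' hlt)
    · exact hne (H₂.2.2.1 h₁ (by omega) h) (H₁.2.2.2 h₁ le_rfl hk)

/-- The map `F` describes, column by column, paths along which every site of the column between the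
level of entrance and the level of departure can be reached, and sideways steps are available at
the level of departure. -/
def IsColumnMap (G : Env) (F : ℤ → ℤ → ℤ) : Prop :=
  ∀ x h, G (x, F x h) = stepsSWE ∧ ∀ y ∈ Set.uIcc h (F x h), Connected G (x, h) (x, y)

theorem isColumnMap_of_firstExit {F : ℤ → ℤ → ℤ} (hF : ∀ x h, FirstExit G x h (F x h)) :
    IsColumnMap G F := by
  intro x h
  obtain ⟨h1, h2, h3⟩ := hF x h
  refine ⟨h1, fun y hy => ?_⟩
  rw [Set.uIcc_of_le h2, Set.mem_Icc] at hy
  obtain ⟨n, rfl⟩ : ∃ n : ℕ, y = h + n := ⟨(y - h).toNat, by omega⟩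
  exact connected_up_run n fun z hz hz' => h3 z hz (by omega)

theorem isColumnMap_of_lowExit {F : ℤ → ℤ → ℤ} (hF : ∀ x h, LowExit G x h (F x h)) :
    IsColumnMap G F := by
  intro x h
  obtain ⟨h1, h2, h3, h4⟩ := hF x h
  refine ⟨h1, fun y hy => ?_⟩
  rw [Set.mem_uIcc] at hy
  rcases hy with hy | hy
  · obtain ⟨n, rfl⟩ : ∃ n : ℕ, y = h + n := ⟨(y - h).toNat, by omega⟩
    exact connected_up_run n fun z hz hz' => h4 z hz (by omega)
  · obtain ⟨n, rfl⟩ : ∃ n : ℕ, y = h - n := ⟨(h - y).toNat, by omega⟩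
    exact connected_down_run n fun z hz hz' => h3 z (by omega) hz'

/-- The levels at which the path with column map `F` that starts at `(x, h)` and moves in direction
`σ` enters the successive columns. -/
def track (F : ℤ → ℤ → ℤ) (σ x h : ℤ) : ℕ → ℤ
  | 0 => h
  | n + 1 => F (x + σ * n) (track F σ x h n)

theorem track_mono {F : ℤ → ℤ → ℤ} (hF : ∀ x, Monotone (F x)) (σ x : ℤ) {h h' : ℤ} (hh : h ≤ h')
    (n : ℕ) : track F σ x h n ≤ track F σ x h' n := by
  induction n with
  | zero => exact hh
  | succ n ih => exact hF _ ih

theorem IsColumnMap.connected_track {F : ℤ → ℤ → ℤ} (hF : IsColumnMap G F) {σ : ℤ}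
    (hσ : σ = 1 ∨ σ = -1) (x h : ℤ) (n : ℕ) :
    Connected G (x, h) (x + σ * n, track F σ x h n) := by
  induction n with
  | zero => simpa [track] using Connected.refl G _
  | succ n ih =>
    have h1 := (hF (x + σ * n) (track F σ x h n)).2 _ Set.right_mem_uIcc
    have h2 := connected_side hσ (hF (x + σ * n) (track F σ x h n)).1
    have : x + σ * ((n + 1 : ℕ) : ℤ) = x + σ * n + σ := by push_cast; ring
    rw [this]
    exact ih.trans (h1.trans h2)

theorem IsColumnMap.connected_uIcc {F : ℤ → ℤ → ℤ} (hF : IsColumnMap G F) {σ : ℤ}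
    (hσ : σ = 1 ∨ σ = -1) (x h : ℤ) (n : ℕ) {y : ℤ}
    (hy : y ∈ Set.uIcc (track F σ x h n) (track F σ x h (n + 1))) :
    Connected G (x, h) (x + σ * n, y) :=
  (hF.connected_track hσ x h n).trans ((hF _ _).2 y hy)

theorem IsMixed.exists_connected_column (hG : IsMixed G) (z : ℤ × ℤ) (x : ℤ) :
    ∃ y, z.2 ≤ y ∧ Connected G z (x, y) := by
  choose F hF using hG.exists_firstExit
  have hmono : ∀ σ n, z.2 ≤ track F σ z.1 z.2 n := by
    intro σ n
    induction n with
    | zero => exact le_rfl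
    | succ n ih => exact ih.trans (hF _ _).2.1
  have hC := isColumnMap_of_firstExit hF
  rcases le_total z.1 x with h | h
  · have := hC.connected_track (Or.inl rfl) z.1 z.2 (x - z.1).toNat
    rw [show z.1 + 1 * ((x - z.1).toNat : ℤ) = x by omega] at this
    exact ⟨_, hmono _ _, this⟩
  · have := hC.connected_track (Or.inr rfl) z.1 z.2 (z.1 - x).toNat
    rw [show z.1 + -1 * ((z.1 - x).toNat : ℤ) = x by omega] at this
    exact ⟨_, hmono _ _, this⟩

/-- A path can walk left along its row until it meets a `stepsUp` site. -/
theorem IsMixed.exists_connected_next_row (hG : IsMixed G) (x h : ℤ) :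
    ∃ x', Connected G (x, h) (x', h + 1) := by
  obtain ⟨n, hn⟩ := hG.up_left x h
  induction n generalizing x with
  | zero => exact ⟨x, connected_up (by simpa using hn)⟩
  | succ n ih =>
    rcases hG.mem (x, h) with hs | hu
    · obtain ⟨x', hx'⟩ := ih (x - 1) (by rw [← hn]; congr 2; push_cast; ring)
      exact ⟨x', (connected_side (Or.inr rfl) hs).trans hx'⟩
    · exact ⟨x, connected_up hu⟩

theorem IsMixed.exists_connected_above (hG : IsMixed G) (z : ℤ × ℤ) (x h : ℤ) :
    ∃ y, h < y ∧ Connected G z (x, y) := by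
  have key : ∀ n : ℕ, ∃ y, z.2 + n ≤ y ∧ Connected G z (x, y) := by
    intro n
    induction n with
    | zero => simpa using hG.exists_connected_column z x
    | succ n ih =>
      obtain ⟨y, hy, hc⟩ := ih
      obtain ⟨x', hx'⟩ := hG.exists_connected_next_row x y
      obtain ⟨y', hy', hc'⟩ := hG.exists_connected_column (x', y + 1) x
      exact ⟨y', by push_cast; simp only at hy'; omega, hc.trans (hx'.trans hc')⟩
  obtain ⟨y, hy, hc⟩ := key (h + 1 - z.2).toNat
  exact ⟨y, by omega, hc⟩

/-! ### Trapping regions and the topological criterion -/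

/-- A finite region, closed under adjacency off the forward cluster of `z`, surrounds every site
that is missed by this cluster. -/
theorem exists_finite_region (hG : IsMixed G) {L : ℤ → ℤ → ℤ} (hL : ∀ x h, LowExit G x h (L x h))
    (hlow : ∀ σ, σ = 1 ∨ σ = -1 → ∀ x h, Filter.Tendsto (track L σ x h) Filter.atTop Filter.atBot)
    {z w : ℤ × ℤ} (hbelow : ∃ y, y < w.2 ∧ Connected G z (w.1, y)) (hw : ¬ Connected G z w) :
    ∃ R : Set (ℤ × ℤ), R.Finite ∧ w ∈ R ∧
      ∀ u ∈ R, ∀ v, lattice.Adj u v → ¬ Connected G z v → v ∈ R := by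
  obtain ⟨b, hb, hcb⟩ := hbelow
  obtain ⟨a, ha, hca⟩ := hG.exists_connected_above z w.1 w.2
  choose F hF using hG.exists_firstExit
  have hCL := isColumnMap_of_lowExit hL
  have hCF := isColumnMap_of_firstExit hF
  set s : ℤ → ℕ → ℤ := fun σ => track L σ w.1 a with hs
  set t : ℤ → ℕ → ℤ := fun σ => track F σ w.1 b with ht
  have hs' : ∀ σ, σ = 1 ∨ σ = -1 → ∀ n y, y ∈ Set.uIcc (s σ n) (s σ (n + 1)) →
      Connected G z (w.1 + σ * n, y) := fun σ hσ n y hy => hca.trans (hCL.connected_uIcc hσ _ _ n hy)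
  have ht' : ∀ σ, σ = 1 ∨ σ = -1 → ∀ n y, y ∈ Set.uIcc (t σ n) (t σ (n + 1)) →
      Connected G z (w.1 + σ * n, y) := fun σ hσ n y hy => hcb.trans (hCF.connected_uIcc hσ _ _ n hy)
  have htm : ∀ σ n, b ≤ t σ n := by
    intro σ n
    induction n with
    | zero => exact le_rfl
    | succ n ih => exact ih.trans (hF _ _).2.1
  have hs0 : ∀ σ σ', s σ 0 = s σ' 0 ∧ s σ 1 = s σ' 1 := fun σ σ' => by simp [hs, track]
  have ht0 : ∀ σ σ', t σ 0 = t σ' 0 ∧ t σ 1 = t σ' 1 := fun σ σ' => by simp [ht, track]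
  -- Here `s` is the falling upper curve and `t` the lower curve. Within a column each curve covers
  -- all levels between its values at the two ends, and these levels are in the cluster; a missed
  -- site is therefore on the same side of a curve at both ends.
  let D : ℤ → ℕ → ℤ → Prop := fun σ n y =>
    (y < s σ n ∧ y < s σ (n + 1)) ∧ (t σ n < y ∧ t σ (n + 1) < y)
  -- a level off the cluster that lies between the two curves at one end lies between them
  have hside : ∀ σ, σ = 1 ∨ σ = -1 → ∀ (n : ℕ) (y : ℤ), ¬ Connected G z (w.1 + σ * n, y) →
      ((y < s σ n ∧ t σ n < y) ∨ (y < s σ (n + 1) ∧ t σ (n + 1) < y)) → D σ n y := by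
    intro σ hσ n y hy h
    have h1 := mt (hs' σ hσ n y) hy
    have h2 := mt (ht' σ hσ n y) hy
    rw [Set.mem_uIcc] at h1 h2
    simp only [D]
    omega
  have hvert : ∀ σ, σ = 1 ∨ σ = -1 → ∀ (n : ℕ) (y y' : ℤ), D σ n y → (y' = y + 1 ∨ y' = y - 1) →
      ¬ Connected G z (w.1 + σ * n, y') → D σ n y' := by
    intro σ hσ n y y' h hy hc
    have h1 := mt (hs' σ hσ n y') hc
    have h2 := mt (ht' σ hσ n y') hc
    rw [Set.mem_uIcc] at h1 h2
    simp only [D] at h ⊢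
    omega
  refine ⟨{v | ∃ σ, (σ = 1 ∨ σ = -1) ∧ ∃ n : ℕ, v.1 = w.1 + σ * n ∧ D σ n v.2}, ?_, ?_, ?_⟩
  -- Once the upper curve is below `b`, which the lower curve never is, nothing lies between them.
  · have hev : ∀ σ, σ = 1 ∨ σ = -1 → ∃ N, ∀ n, N ≤ n → s σ n ≤ b := fun σ hσ =>
      Filter.eventually_atTop.1 ((hlow σ hσ w.1 a).eventually_le_atBot b)
    choose! N hN using hev
    have hfin : (⋃ σ ∈ ({1, -1} : Set ℤ), ⋃ n ∈ Set.Iio (N σ),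
        ({w.1 + σ * n} : Set ℤ) ×ˢ Set.Ioo (t σ n) (s σ n)).Finite :=
      (Set.toFinite _).biUnion fun σ _ => (Set.finite_Iio _).biUnion fun n _ =>
        (Set.finite_singleton _).prod (Set.finite_Ioo _ _)
    refine hfin.subset ?_
    rintro v ⟨σ, hσ, n, hv, hD⟩
    simp only [Set.mem_iUnion]
    refine ⟨σ, by simpa using hσ, n, ?_, by simpa using hv, hD.2.1, hD.1.1⟩
    rw [Set.mem_Iio]
    by_contra! hn
    have := hN σ hσ n hn
    have := htm σ n
    have := hD.1.1
    have := hD.2.1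
    omega
  · refine ⟨1, Or.inl rfl, 0, by simp, hside 1 (Or.inl rfl) 0 w.2 (by simpa using hw) (Or.inl ?_)⟩
    simpa [hs, ht, track] using ⟨ha, hb⟩
  · rintro ⟨u₁, u₂⟩ ⟨σ, hσ, n, hu, hD⟩ ⟨v₁, v₂⟩ hadj hv
    simp only at hu hD
    have hadj' : (v₁ = u₁ ∧ (v₂ = u₂ + 1 ∨ v₂ = u₂ - 1)) ∨ (v₂ = u₂ ∧ (v₁ = u₁ + 1 ∨ v₁ = u₁ - 1)) := by
      simp only [lattice, unitSteps, Set.mem_insert_iff, Set.mem_singleton_iff, Prod.mk_sub_mk,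
        Prod.mk.injEq] at hadj
      omega
    rcases hadj' with ⟨rfl, h⟩ | ⟨rfl, h⟩
    · exact ⟨σ, hσ, n, hu, hvert σ hσ n u₂ v₂ hD h (by rwa [← hu])⟩
    · have hout : ∀ σ, σ = 1 ∨ σ = -1 → ∀ n : ℕ, D σ n v₂ →
          v₁ = w.1 + σ * ((n + 1 : ℕ) : ℤ) → ∃ σ, (σ = 1 ∨ σ = -1) ∧ ∃ n : ℕ, v₁ = w.1 + σ * n ∧ D σ n v₂ :=
        fun σ hσ n hD hv₁ => ⟨σ, hσ, n + 1, hv₁,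
          hside σ hσ (n + 1) v₂ (by rwa [← hv₁]) (Or.inl ⟨hD.1.2, hD.2.2⟩)⟩
      have hcase : v₁ = u₁ + σ ∨ v₁ = u₁ - σ := by rcases hσ with rfl | rfl <;> omega
      rcases hcase with hv₁ | hv₁
      · exact hout σ hσ n hD (by rw [hv₁, hu]; push_cast; ring)
      · rcases n with _ | n
        -- The central column `n = 0` belongs to both halves; leaving it backwards means entering
        -- column 1 of the other half.
        · refine hout (-σ) (by omega) 0 ?_ (by rw [hv₁, hu]; push_cast; ring)
          simp only [D, (hs0 (-σ) σ).1, (hs0 (-σ) σ).2, (ht0 (-σ) σ).1, (ht0 (-σ) σ).2, zero_add] at hD ⊢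
          exact hD
        · have hv₂ : v₁ = w.1 + σ * n := by rw [hv₁, hu]; push_cast; ring
          exact ⟨σ, hσ, n, hv₂, hside σ hσ n v₂ (by rwa [← hv₂]) (Or.inr ⟨hD.1.1, hD.2.1⟩)⟩

theorem IsMixed.adj (hG : IsMixed G) {u v : ℤ × ℤ} (h : v - u ∈ G u) : lattice.Adj u v := by
  show v - u ∈ unitSteps
  rcases hG.mem u with hu | hu <;> rw [hu] at h
  · simp only [stepsSWE, unitSteps, Set.mem_insert_iff, Set.mem_singleton_iff] at h ⊢
    tauto
  · simp only [stepsUp, unitSteps, Set.mem_insert_iff, Set.mem_singleton_iff] at h ⊢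
    tauto

theorem forwardCluster_infinite (hG : IsMixed G) (z : ℤ × ℤ) : (forwardCluster G z).Infinite := by
  intro hfin
  obtain ⟨h, hh⟩ := (hfin.image Prod.snd).bddAbove
  obtain ⟨y, hy, hc⟩ := hG.exists_connected_above z 0 h
  exact absurd (hh ⟨_, hc, rfl⟩) (not_le.2 hy)

/-- Finite trapping regions are used twice: around `x`, to see that no forward cluster misses it (a
missed `x` would have its whole backward cluster trapped), and around each site outside the forward
cluster of `x`, to bound its complementary component. -/
theorem hasGiganticComponent_of_isMixed (hG : IsMixed G) {L : ℤ → ℤ → ℤ}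
    (hL : ∀ x h, LowExit G x h (L x h))
    (hlow : ∀ σ, σ = 1 ∨ σ = -1 → ∀ x h, Filter.Tendsto (track L σ x h) Filter.atTop Filter.atBot)
    (hbelow : ∀ z x h, ∃ y, y < h ∧ Connected G z (x, y))
    (hback : ∃ x, (backwardCluster G x).Infinite) : HasGiganticComponent G := by
  have hreg := fun z w => exists_finite_region hG hL hlow (hbelow z w.1 w.2) (z := z) (w := w)
  obtain ⟨x, hx⟩ := hback
  -- `x` can be reached from everywhere
  have hall : ∀ z, Connected G z x := by
    intro z
    by_contra hz
    obtain ⟨R, hfin, hxR, hR⟩ := hreg z x hz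
    refine hx (hfin.subset fun y hy => ?_)
    refine Relation.ReflTransGen.head_induction_on (motive := fun y _ => y ∈ R) hy hxR ?_
    intro u v huv hvx hv
    refine hR v hv u (hG.adj huv).symm fun hzu => hz ?_
    exact hzu.trans ((connected_step huv).trans hvx)
  have hM : mutualCluster G x = forwardCluster G x :=
    Set.inter_eq_right.2 fun z _ => hall z
  refine ⟨x, hM ▸ forwardCluster_infinite hG x, fun K => ?_⟩
  induction K using SimpleGraph.ConnectedComponent.ind with
  | _ w =>
    have hw : ∀ v : ↥(mutualCluster G x)ᶜ, ¬ Connected G x v.1 := fun v hv => v.2 (hM.ge hv)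
    obtain ⟨R, hfin, hwR, hR⟩ := hreg x w.1 (hw w)
    refine (hfin.preimage Subtype.val_injective.injOn).subset fun v hv => ?_
    have hwalk : ∀ {a b : ↥(mutualCluster G x)ᶜ},
        (lattice.induce (mutualCluster G x)ᶜ).Walk a b → a.1 ∈ R → b.1 ∈ R := by
      intro a b p
      induction p with
      | nil => exact id
      | cons hadj _ ih => exact fun ha => ih (hR _ ha _ hadj (hw _))
    obtain ⟨p⟩ := SimpleGraph.ConnectedComponent.exact hv.symm
    exact hwalk p hwR
-- Low paths in the random environment and the gigantic component
theorem ae_eventually_notMem_of_le_geometric {Ω : Type*} [MeasurableSpace Ω] {μ : Measure Ω}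
    {s : ℕ → Set Ω} {C r : ℝ} (hC : 0 ≤ C) (hr : 0 ≤ r) (hr1 : r < 1)
    (h : ∀ n, μ (s n) ≤ ENNReal.ofReal (C * r ^ n)) :
    ∀ᵐ ω ∂μ, ∀ᶠ n in Filter.atTop, ω ∉ s n := by
  refine ae_eventually_notMem (ne_top_of_le_ne_top ?_ (ENNReal.tsum_le_tsum h))
  rw [← ENNReal.ofReal_tsum_of_nonneg (fun n => by positivity)
    ((summable_geometric_of_lt_one hr hr1).mul_left C)]
  exact ENNReal.ofReal_ne_top

/-- The environments whose low path from `(a, b)` in direction `σ` satisfies `Q` after `n`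
columns. -/
def lowEvent (σ a b : ℤ) (n : ℕ) (Q : ℤ → Prop) : Set Env :=
  {G | ∃ L : ℤ → ℤ → ℤ, (∀ x h, LowExit G x h (L x h)) ∧ Q (track L σ a b n)}

theorem LowExit.exists_occurs {G : Env} {σ a x h h' : ℤ} (H : LowExit G (a + σ * x) h h') :
    ∃ i, (edgeFamily ()).Occurs (fun z => {G : Env | G (a + σ * z.1, z.2) = stepsUp})
      (fun z => {G : Env | G (a + σ * z.1, z.2) = stepsSWE}) i x h G ∧
        h + (edgeFamily ()).disp i = h' := by
  obtain ⟨h1, h2, h3, h4⟩ := H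
  rcases le_or_gt h' h with hh | hh
  · refine ⟨.inr (h - h').toNat, ⟨?_, ?_⟩, ?_⟩
    · have e : h - ((h - h').toNat : ℤ) - 1 = h' - 1 := by omega
      intro z hz
      simp only [edgeFamily, e, Finset.mem_singleton] at hz
      subst hz
      exact h2
    · rintro ⟨z₁, z₂⟩ hz
      simp only [edgeFamily, mem_vseg] at hz
      obtain ⟨rfl, hz, hz'⟩ := hz
      exact h3 _ (by omega) hz'
    · simp only [edgeFamily]
      omega
  · refine ⟨.inl (h' - h - 1).toNat, ⟨?_, ?_⟩, ?_⟩
    · rintro ⟨z₁, z₂⟩ hz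
      simp only [edgeFamily, mem_vseg] at hz
      obtain ⟨rfl, hz, hz'⟩ := hz
      exact h4 _ hz (by omega)
    · have e : h + ((h' - h - 1).toNat : ℤ) + 1 = h' := by omega
      intro z hz
      simp only [edgeFamily, e, Finset.mem_singleton] at hz
      subst hz
      exact h1
    · simp only [edgeFamily]
      omega

theorem lowEvent_subset (σ a b : ℤ) (n : ℕ) (Q : ℤ → Prop) :
    lowEvent σ a b n Q ⊆ {G | StepFamily.Reach edgeFamily
      (fun z => {G : Env | G (a + σ * z.1, z.2) = stepsUp})
      (fun z => {G : Env | G (a + σ * z.1, z.2) = stepsSWE}) Q n () 0 b G} := by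
  rintro G ⟨L, hL, hQ⟩
  have key : ∀ n k : ℕ, Q (track L σ a b (k + n)) → StepFamily.Reach edgeFamily
      (fun z => {G : Env | G (a + σ * z.1, z.2) = stepsUp})
      (fun z => {G : Env | G (a + σ * z.1, z.2) = stepsSWE}) Q n () k (track L σ a b k) G := by
    intro n
    induction n with
    | zero => exact fun k h => h
    | succ n ih =>
      intro k h
      obtain ⟨i, hi, hd⟩ := (hL (a + σ * k) (track L σ a b k)).exists_occurs
      refine ⟨i, hi, ?_⟩
      rw [hd]
      have := ih (k + 1) (by rwa [show k + 1 + n = k + (n + 1) by omega])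
      push_cast at this
      exact this
  exact key n 0 (by rwa [zero_add])

section
variable {p : ℝ}

/-- The `stepsUp` sites, of probability `1 - p`, play the open sites, hence the `swap`; the
injection turns motion in direction `σ` from column `a` into motion to the right from column 0.
Values t > 1 bound low paths from above, values t < 1 from below. -/
theorem measure_lowEvent_le (hp : 0 < p) (hp1 : p < 1) {σ : ℤ} (hσ : σ = 1 ∨ σ = -1) {t : ℝ}
    (hpt : p < t) (hqt : (1 - p) * t < 1) {Q : ℤ → Prop} (m : ℤ)
    (hQ : ∀ h, Q h → 1 ≤ t ^ (h - m)) (a b : ℤ) (n : ℕ) :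
    envLaw stepsSWE stepsUp p (lowEvent σ a b n Q) ≤ ENNReal.ofReal
      ((p * (1 - p) * t / (1 - (1 - p) * t) + p * (1 - p) * t / (t - p)) ^ n * t ^ (b - m)) := by
  have hinj : Function.Injective fun z : ℤ × ℤ => (a + σ * z.1, z.2) := by
    rintro ⟨x, y⟩ ⟨x', y'⟩ h
    simp only [Prod.mk.injEq] at h ⊢
    rcases hσ with rfl | rfl <;> omega
  have H := (isSiteField_envLaw stepsSWE_ne_stepsUp hp.le hp1.le).swap.comp hinj
  exact (measure_mono (lowEvent_subset σ a b n Q)).trans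
    (measure_reach_edgeFamily_le hp.le (by linarith) (hp.trans hpt) hqt hpt H m hQ n 0 b)

theorem ae_isMixed (hp : 0 < p) (hp1 : p < 1) : ∀ᵐ G ∂(envLaw stepsSWE stepsUp p), IsMixed G := by
  have H := isSiteField_envLaw stepsSWE_ne_stepsUp hp.le hp1.le
  have hlt : ENNReal.ofReal p < 1 := by simpa using hp1
  have hlt' : ENNReal.ofReal (1 - p) < 1 := by simpa using hp
  have h1 : ∀ᵐ G ∂(envLaw stepsSWE stepsUp p), ∀ x h : ℤ, ∃ n : ℕ, G (x, h + n) ≠ stepsUp :=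
    ae_all_iff.2 fun x => ae_all_iff.2 fun h =>
      H.ae_exists_notMem hlt' (f := fun n => (x, h + n)) fun m n h => by simpa using h
  have h2 : ∀ᵐ G ∂(envLaw stepsSWE stepsUp p), ∀ x h : ℤ, ∃ n : ℕ, G (x, h - n) ≠ stepsSWE :=
    ae_all_iff.2 fun x => ae_all_iff.2 fun h =>
      H.swap.ae_exists_notMem hlt (f := fun n => (x, h - n)) fun m n h => by simpa using h
  have h3 : ∀ᵐ G ∂(envLaw stepsSWE stepsUp p), ∀ x h : ℤ, ∃ n : ℕ, G (x - n, h) ≠ stepsSWE :=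
    ae_all_iff.2 fun x => ae_all_iff.2 fun h =>
      H.swap.ae_exists_notMem hlt (f := fun n => (x - n, h)) fun m n h => by simpa using h
  filter_upwards [h1, h2, h3, ae_envLaw_mem (A := stepsSWE) (B := stepsUp) hp.le hp1.le]
    with G h1 h2 h3 hm
  refine ⟨hm, fun x h => ?_, fun x h => ?_, fun x h => ?_⟩
  · obtain ⟨n, hn⟩ := h1 x h
    exact ⟨h + n, by omega, (hm _).resolve_right hn⟩
  · obtain ⟨n, hn⟩ := h2 x h
    exact ⟨h - n, by omega, (hm _).resolve_left hn⟩
  · obtain ⟨n, hn⟩ := h3 x h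
    exact ⟨n, (hm _).resolve_left hn⟩

theorem one_le_zpow_sub {t : ℝ} (ht : 1 < t) {m h : ℤ} (hh : m ≤ h) : 1 ≤ t ^ (h - m) :=
  one_le_zpow₀ ht.le (by omega)

/-- Backward clusters are infinite for some site as soon as, for all large `k`, every site of the
gate `{0} × [k ^ 2, (k + 1) ^ 2]` leads to the gate `{0} × [0, k ^ 2]`. -/
theorem exists_infinite_backwardCluster {G : Env} {k₀ : ℕ}
    (h : ∀ k : ℕ, k₀ ≤ k → ∀ s : ℤ, (k : ℤ) ^ 2 ≤ s → s ≤ ((k : ℤ) + 1) ^ 2 →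
      ∃ s' : ℤ, 0 ≤ s' ∧ s' ≤ (k : ℤ) ^ 2 ∧ Connected G (0, s) (0, s')) :
    ∃ x, (backwardCluster G x).Infinite := by
  have key : ∀ n : ℕ, ∀ s : ℤ, 0 ≤ s → s ≤ ((k₀ + n : ℕ) : ℤ) ^ 2 →
      ∃ s' : ℤ, 0 ≤ s' ∧ s' ≤ (k₀ : ℤ) ^ 2 ∧ Connected G (0, s) (0, s') := by
    intro n
    induction n with
    | zero => exact fun s h0 h1 => ⟨s, h0, by simpa using h1, Connected.refl G _⟩
    | succ n ih =>
      intro s h0 h1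
      rcases le_total s (((k₀ + n : ℕ) : ℤ) ^ 2) with hs | hs
      · exact ih s h0 hs
      · obtain ⟨s', h2, h3, h4⟩ := h (k₀ + n) (by omega) s hs (by push_cast at h1 ⊢; linarith)
        obtain ⟨s'', h5, h6, h7⟩ := ih s' h2 h3
        exact ⟨s'', h5, h6, h4.trans h7⟩
  by_contra! hfin
  have hU : (⋃ s' ∈ Set.Icc (0 : ℤ) ((k₀ : ℤ) ^ 2), backwardCluster G (0, s')).Finite :=
    (Set.finite_Icc _ _).biUnion fun s _ => hfin _
  refine Set.infinite_of_injective_forall_mem (f := fun n : ℕ => ((0 : ℤ), (n : ℤ)))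
    (fun m n h => by simpa using h) (fun n => ?_) hU
  obtain ⟨s', h0, h1, h2⟩ := key n n (by omega) (by
    have h1 : (n : ℤ) ≤ (n : ℤ) ^ 2 := Int.le_self_sq _
    have h2 : (0 : ℤ) ≤ k₀ * n := by positivity
    push_cast
    nlinarith)
  simp only [Set.mem_iUnion]
  exact ⟨s', ⟨h0, h1⟩, h2⟩

/-- By monotonicity, four low paths from deterministic levels sandwich the excursion that goes `m`
columns to the right and back from any `s` in the gate. -/
theorem exists_out_and_back {G : Env} {L : ℤ → ℤ → ℤ} (hL : ∀ x h, LowExit G x h (L x h))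
    {m : ℕ} {s s₁ s₂ u u₁ u₂ : ℤ} (hs : s₁ ≤ s) (hs' : s ≤ s₂)
    (hu₁ : u₁ ≤ track L 1 0 s₁ m) (hu₂ : track L 1 0 s₂ m ≤ u₂)
    (hu : u ≤ track L (-1) m u₁ m) (hu' : track L (-1) m u₂ m ≤ s₁) :
    ∃ s', u ≤ s' ∧ s' ≤ s₁ ∧ Connected G (0, s) (0, s') := by
  have hmono : ∀ x, Monotone (L x) := fun x h h' hh => (hL x h).mono (hL x h') hh
  have hC := isColumnMap_of_lowExit hL
  have h1 := hC.connected_track (Or.inl rfl) 0 s m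
  have h2 := hC.connected_track (Or.inr rfl) m (track L 1 0 s m) m
  rw [show (0 : ℤ) + 1 * m = m by ring] at h1
  rw [show (m : ℤ) + -1 * m = 0 by ring] at h2
  refine ⟨_, hu.trans (track_mono hmono _ _ (hu₁.trans (track_mono hmono _ _ hs m)) m),
    (track_mono hmono _ _ ((track_mono hmono _ _ hs' m).trans hu₂) m).trans hu', h1.trans h2⟩

theorem ae_tendsto_track (hp : 0 < p) (hp1 : p < 1) (h : (1 - p) ^ 2 < p ^ 3) :
    ∀ᵐ G ∂(envLaw stepsSWE stepsUp p), ∀ L : ℤ → ℤ → ℤ, (∀ x h, LowExit G x h (L x h)) →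
      ∀ σ, σ = 1 ∨ σ = -1 → ∀ x h, Filter.Tendsto (track L σ x h) Filter.atTop Filter.atBot := by
  obtain ⟨t, ht1, hqt, hM⟩ := exists_edge_moment_lt_one (q := 1 - p) (by ring) hp (by linarith) h
  have hM0 : 0 ≤ p * (1 - p) * t / (1 - (1 - p) * t) + p * (1 - p) * t / (t - p) := by
    have : 0 < 1 - p := by linarith
    have : 0 < 1 - (1 - p) * t := by linarith
    have : 0 < t - p := by linarith
    positivity
  have hae : ∀ σ, ∀ᵐ G ∂(envLaw stepsSWE stepsUp p), σ = 1 ∨ σ = -1 → ∀ x h m : ℤ,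
      ∀ᶠ n in Filter.atTop, G ∉ lowEvent σ x h n (fun y => m ≤ y) := by
    intro σ
    by_cases hσ : σ = 1 ∨ σ = -1
    · have : ∀ᵐ G ∂(envLaw stepsSWE stepsUp p), ∀ x h m : ℤ,
          ∀ᶠ n in Filter.atTop, G ∉ lowEvent σ x h n (fun y => m ≤ y) :=
        ae_all_iff.2 fun x => ae_all_iff.2 fun h => ae_all_iff.2 fun m =>
          ae_eventually_notMem_of_le_geometric (C := t ^ (h - m)) (by positivity) hM0 hM fun n =>
            (measure_lowEvent_le hp hp1 hσ (by linarith) hqt m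
              (fun y hy => one_le_zpow_sub ht1 hy) x h n).trans_eq (by rw [mul_comm])
      filter_upwards [this] with G hG _ using hG
    · exact Filter.Eventually.of_forall fun G hG => absurd hG hσ
  filter_upwards [ae_all_iff.2 hae] with G hG L hL σ hσ x h
  refine Filter.tendsto_atBot.2 fun m => ?_
  filter_upwards [hG σ hσ x h m] with n hn
  exact (not_le.1 fun hm => hn ⟨L, hL, hm⟩).le

/-- Follow the low path left to column `x - n`, where for large `n` it is no higher than `z.2`, then
a low path right to column `x`. Monotonicity compares the return with the path from the
deterministic level `z.2`, to which Borel-Cantelli over `n` applies. -/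
theorem ae_exists_connected_below (hp : 0 < p) (hp1 : p < 1) (h : (1 - p) ^ 2 < p ^ 3) :
    ∀ᵐ G ∂(envLaw stepsSWE stepsUp p), ∀ (z : ℤ × ℤ) (x h : ℤ),
      ∃ y, y < h ∧ Connected G z (x, y) := by
  obtain ⟨t, ht1, hqt, hM⟩ := exists_edge_moment_lt_one (q := 1 - p) (by ring) hp (by linarith) h
  have hM0 : 0 ≤ p * (1 - p) * t / (1 - (1 - p) * t) + p * (1 - p) * t / (t - p) := by
    have : 0 < 1 - p := by linarith
    have : 0 < 1 - (1 - p) * t := by linarith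
    have : 0 < t - p := by linarith
    positivity
  have hae : ∀ᵐ G ∂(envLaw stepsSWE stepsUp p), ∀ b x h : ℤ,
      ∀ᶠ n : ℕ in Filter.atTop, G ∉ lowEvent 1 (x - n) b n (fun y => h ≤ y) :=
    ae_all_iff.2 fun b => ae_all_iff.2 fun x => ae_all_iff.2 fun h =>
      ae_eventually_notMem_of_le_geometric (C := t ^ (b - h)) (by positivity) hM0 hM fun n =>
        (measure_lowEvent_le hp hp1 (Or.inl rfl) (by linarith) hqt h
          (fun y hy => one_le_zpow_sub ht1 hy) (x - n) b n).trans_eq (by rw [mul_comm])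
  filter_upwards [hae, ae_tendsto_track hp hp1 h, ae_isMixed hp hp1] with G h1 h2 hG z x h
  choose L hL using hG.exists_lowExit
  have hmono : ∀ x, Monotone (L x) := fun x h h' hh => (hL x h).mono (hL x h') hh
  have hC := isColumnMap_of_lowExit hL
  have htend : Filter.Tendsto (fun n : ℕ => (z.1 - x + n).toNat) Filter.atTop Filter.atTop :=
    Filter.tendsto_atTop.2 fun b => Filter.eventually_atTop.2
      ⟨b + (x - z.1).toNat, fun n hn => by omega⟩
  obtain ⟨n, hn1, hn2, hn3⟩ := ((h1 z.2 x h).and (((((h2 L hL (-1) (Or.inr rfl) z.1 z.2).comp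
    htend).eventually_le_atBot z.2)).and (Filter.eventually_ge_atTop (x - z.1).toNat))).exists
  have c1 := hC.connected_track (Or.inr rfl) z.1 z.2 (z.1 - x + n).toNat
  rw [show z.1 + -1 * ((z.1 - x + n).toNat : ℤ) = x - n by omega] at c1
  have c2 := hC.connected_track (Or.inl rfl) (x - n) (track L (-1) z.1 z.2 (z.1 - x + n).toNat) n
  rw [show x - (n : ℤ) + 1 * n = x by ring] at c2
  refine ⟨_, ?_, c1.trans c2⟩
  exact (track_mono hmono _ _ hn2 n).trans_lt (not_le.1 fun hm => hn1 ⟨L, hL, hm⟩)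

/-- From the `k`-th gate, of length `2 * k + 1`, go out a number of columns linear in `k` and back.
This is long enough to descend past the whole gate, but the descent is only linear in `k` and so
stops above 0, as the gate lies at height at least `k ^ 2`. The failure probabilities are summable
in `k`. -/
theorem ae_exists_infinite_backwardCluster (hp : 0 < p) (hp1 : p < 1) (h : (1 - p) ^ 2 < p ^ 3) :
    ∀ᵐ G ∂(envLaw stepsSWE stepsUp p), ∃ x, (backwardCluster G x).Infinite := by
  obtain ⟨t, ht1, hqt, hM⟩ := exists_edge_moment_lt_one (q := 1 - p) (by ring) hp (by linarith) h
  set M := p * (1 - p) * t / (1 - (1 - p) * t) + p * (1 - p) * t / (t - p) with hMdef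
  have hM0 : 0 ≤ M := by
    have : 0 < 1 - p := by linarith
    have : 0 < 1 - (1 - p) * t := by linarith
    have : 0 < t - p := by linarith
    positivity
  -- the speed at which low paths descend is at least `1 / K` and at most `c`
  obtain ⟨K, hK1, hK⟩ : ∃ K : ℕ, 1 ≤ K ∧ M ^ K * t ≤ 1 / 2 := by
    obtain ⟨K, hK⟩ := exists_pow_lt_of_lt_one (show 0 < 1 / (2 * t) by positivity) hM
    refine ⟨K + 1, by omega, ?_⟩
    have h1 : M ^ (K + 1) ≤ 1 / (2 * t) := (pow_le_pow_of_le_one hM0 hM.le (by omega)).trans hK.le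
    calc M ^ (K + 1) * t ≤ 1 / (2 * t) * t := by gcongr
      _ = 1 / 2 := by field_simp
  -- Any value strictly between p and 1 serves: r < 1 penalises low levels, and r > p makes the
  -- downward geometric series converge.
  set r := (1 + p) / 2 with hr
  have hr0 : 0 < r := by positivity
  have hr1 : r < 1 := by rw [hr]; linarith
  have hpr : p < r := by rw [hr]; linarith
  have hqr : (1 - p) * r < 1 := by nlinarith
  set M' := p * (1 - p) * r / (1 - (1 - p) * r) + p * (1 - p) * r / (r - p) with hM'def
  have hM'0 : 0 ≤ M' := by
    have : 0 < 1 - p := by linarith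
    have : 0 < 1 - (1 - p) * r := by linarith
    have : 0 < r - p := by linarith
    positivity
  obtain ⟨c, hc⟩ : ∃ c : ℕ, M' * r ^ c ≤ 1 / 2 := by
    obtain ⟨c, hc⟩ := exists_pow_lt_of_lt_one (show 0 < 1 / (2 * (M' + 1)) by positivity) hr1
    refine ⟨c, ?_⟩
    calc M' * r ^ c ≤ (M' + 1) * (1 / (2 * (M' + 1))) := by gcongr; linarith
      _ = 1 / 2 := by field_simp
  -- With `K` columns per level, the bound for failing to descend `2 * k + 1` levels is at most `(M
  -- ^ K * t) ^ (2 * k + 1)`.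
  let m : ℕ → ℕ := fun k => K * (2 * k + 1)
  have hkm : ∀ k, k ≤ m k := fun k => by simp only [m]; nlinarith
  have hhalf : ∀ k, (1 / 2 : ℝ) ^ m k ≤ 1 * (1 / 2) ^ k := fun k => by
    rw [one_mul]
    exact pow_le_pow_of_le_one (by norm_num) (by norm_num) (hkm k)
  have hhalf' : ∀ k : ℕ, (1 / 2 : ℝ) ^ (2 * k + 1) ≤ 1 * (1 / 2) ^ k := fun k => by
    rw [one_mul]
    exact pow_le_pow_of_le_one (by norm_num) (by norm_num) (by omega)
  have hMm : ∀ k, M ^ m k * t ^ ((2 * k : ℕ) : ℤ) ≤ 1 * (1 / 2) ^ k := fun k => by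
    refine le_trans ?_ (hhalf' k)
    calc M ^ m k * t ^ ((2 * k : ℕ) : ℤ) ≤ (M ^ K) ^ (2 * k + 1) * t ^ (2 * k + 1) := by
          rw [zpow_natCast, ← pow_mul]
          gcongr
          · exact ht1.le
          · omega
      _ = (M ^ K * t) ^ (2 * k + 1) := (mul_pow _ _ _).symm
      _ ≤ _ := by gcongr
  have hdown : ∀ {σ : ℤ} (hσ : σ = 1 ∨ σ = -1) (a b : ℕ → ℤ),
      ∀ᵐ G ∂(envLaw stepsSWE stepsUp p), ∀ᶠ k in Filter.atTop,
        G ∉ lowEvent σ (a k) (b k) (m k) (fun y => y ≤ b k - c * m k) := by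
    intro σ hσ a b
    refine ae_eventually_notMem_of_le_geometric (C := 1) (r := 1 / 2) (by norm_num) (by norm_num)
      (by norm_num) fun k => ?_
    refine (measure_lowEvent_le hp hp1 hσ hpr hqr (b k - c * m k) (fun y hy => ?_) _ _ _).trans
      (ENNReal.ofReal_le_ofReal (le_trans ?_ (hhalf k)))
    · obtain ⟨j, hj⟩ : ∃ j : ℕ, b k - c * m k - y = j := ⟨(b k - c * m k - y).toNat, by omega⟩
      rw [show y - (b k - c * m k) = -(j : ℤ) by omega, zpow_neg, zpow_natCast]
      exact (one_le_inv₀ (by positivity)).2 (pow_le_one₀ hr0.le hr1.le)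
    · rw [show b k - (b k - (c : ℤ) * m k) = ((c * m k : ℕ) : ℤ) by push_cast; ring, zpow_natCast]
      calc M' ^ m k * r ^ (c * m k) = (M' * r ^ c) ^ m k := by rw [mul_pow, ← pow_mul r]
        _ ≤ (1 / 2) ^ m k := by gcongr
  have hup : ∀ {σ : ℤ} (hσ : σ = 1 ∨ σ = -1) (a b b' : ℕ → ℤ), (∀ k, b k - b' k ≤ 2 * k) →
      ∀ᵐ G ∂(envLaw stepsSWE stepsUp p), ∀ᶠ k in Filter.atTop,
        G ∉ lowEvent σ (a k) (b k) (m k) (fun y => b' k ≤ y) := by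
    intro σ hσ a b b' hb
    refine ae_eventually_notMem_of_le_geometric (C := 1) (r := 1 / 2) (by norm_num) (by norm_num)
      (by norm_num) fun k => ?_
    refine (measure_lowEvent_le hp hp1 hσ (by linarith) hqt (b' k)
      (fun y hy => one_le_zpow_sub ht1 hy) _ _ _).trans
      (ENNReal.ofReal_le_ofReal (le_trans ?_ (hMm k)))
    gcongr
    · exact ht1.le
    · push_cast
      exact hb k
  -- On the way out the upper path need only not climb; on the way back it must fall from `(k + 1) ^
  -- 2` to `k ^ 2`. The added 1 turns "not at least" into "at most", and the admissible difference
  -- is then exactly `2 * k`.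
  filter_upwards [hup (Or.inl rfl) (fun _ => 0) (fun k => ((k : ℤ) + 1) ^ 2)
      (fun k => ((k : ℤ) + 1) ^ 2 + 1) (fun k => by omega),
    hup (Or.inr rfl) (fun k => m k) (fun k => ((k : ℤ) + 1) ^ 2) (fun k => (k : ℤ) ^ 2 + 1)
      (fun k => by linarith [show ((k : ℤ) + 1) ^ 2 = (k : ℤ) ^ 2 + 2 * k + 1 by ring]),
    hdown (Or.inl rfl) (fun _ => 0) (fun k => (k : ℤ) ^ 2),
    hdown (Or.inr rfl) (fun k => m k) (fun k => (k : ℤ) ^ 2 - c * m k), ae_isMixed hp hp1]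
    with G h1 h2 h3 h4 hG
  choose L hL using hG.exists_lowExit
  obtain ⟨k₀, hk₀⟩ := Filter.eventually_atTop.1 (h1.and (h2.and (h3.and h4)))
  -- The total descent is at most 2cK(2k+1), which is at most 6cKk for k ≥ 1, hence at most k^2 once
  -- k ≥ 6cK.
  refine exists_infinite_backwardCluster (k₀ := max k₀ (6 * c * K)) fun k hk s hs hs' => ?_
  obtain ⟨g1, g2, g3, g4⟩ := hk₀ k (le_of_max_le_left hk)
  have hk' : 6 * c * K ≤ k := le_of_max_le_right hk
  have e1 : track L 1 0 (((k : ℤ) + 1) ^ 2) (m k) ≤ ((k : ℤ) + 1) ^ 2 :=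
    Int.lt_add_one_iff.1 (not_le.1 fun hm => g1 ⟨L, hL, hm⟩)
  have e2 : track L (-1) (m k) (((k : ℤ) + 1) ^ 2) (m k) ≤ (k : ℤ) ^ 2 :=
    Int.lt_add_one_iff.1 (not_le.1 fun hm => g2 ⟨L, hL, hm⟩)
  have e3 : (k : ℤ) ^ 2 - c * m k ≤ track L 1 0 ((k : ℤ) ^ 2) (m k) :=
    (not_le.1 fun hm => g3 ⟨L, hL, hm⟩).le
  have e4 : (k : ℤ) ^ 2 - c * m k - c * m k ≤ track L (-1) (m k) ((k : ℤ) ^ 2 - c * m k) (m k) :=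
    (not_le.1 fun hm => g4 ⟨L, hL, hm⟩).le
  obtain ⟨s', hs1, hs2, hs3⟩ := exists_out_and_back hL hs hs' e3 e1 e4 e2
  refine ⟨s', le_trans ?_ hs1, hs2, hs3⟩
  have hnat : 2 * (c * m k) ≤ k ^ 2 := by
    simp only [m]
    rcases Nat.eq_zero_or_pos k with rfl | hkpos
    · have : c * K = 0 := by nlinarith
      nlinarith
    · nlinarith [Nat.mul_le_mul_right k hk', Nat.zero_le (c * K)]
  have hint : 2 * ((c : ℤ) * m k) ≤ (k : ℤ) ^ 2 := by exact_mod_cast hnat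
  linarith

theorem ae_hasGiganticComponent (hp : 0 < p) (hp1 : p < 1) (h : (1 - p) ^ 2 < p ^ 3) :
    ∀ᵐ G ∂(envLaw stepsSWE stepsUp p), HasGiganticComponent G := by
  filter_upwards [ae_isMixed hp hp1, ae_tendsto_track hp hp1 h, ae_exists_connected_below hp hp1 h,
    ae_exists_infinite_backwardCluster hp hp1 h] with G hG h1 h2 h3
  choose L hL using hG.exists_lowExit
  exact hasGiganticComponent_of_isMixed hG hL (h1 L hL) h2 h3

end
-- The two-state exploration for five-neighbour percolation
/-- The indices of the local events that refine those of `edgeFamily`. In the state `false`, when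
the highest accessible open site is found by going down, the state of the three sites below it is
revealed, too, and the state becomes `true` if they are all closed. -/
abbrev RefinedIndex : Bool → Type
  | false => ℕ ⊕ ((ℕ × Fin 3) ⊕ ℕ)
  | true => ℕ ⊕ (ℕ ⊕ Unit)

instance (s : Bool) : Countable (RefinedIndex s) := by
  cases s <;> infer_instance

/-- The refined local events that start from the normal state. -/
noncomputable def normalFamily : StepFamily Bool (RefinedIndex false) where
  opn i x h := match i with
    | .inl j => vseg x h (h + j)
    | .inr (.inl (j, r)) => {(x, h - j - 1), (x, h - j - 2 - r)}
    | .inr (.inr j) => {(x, h - j - 1)}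
  cls i x h := match i with
    | .inl j => {(x, h + j + 1)}
    | .inr (.inl (j, r)) => vseg x (h - j) h ∪ vseg x (h - j - 1 - r) (h - j - 2)
    | .inr (.inr j) => vseg x (h - j) h ∪ vseg x (h - j - 4) (h - j - 2)
  disp i := match i with
    | .inl j => j + 1
    | .inr (.inl (j, _)) => -j
    | .inr (.inr j) => -j
  next i := match i with
    | .inl _ => false
    | .inr (.inl _) => false
    | .inr (.inr _) => true
  numOpn i := match i with
    | .inl j => j + 1
    | .inr (.inl _) => 2
    | .inr (.inr _) => 1
  numCls i := match i with
    | .inl _ => 1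
    | .inr (.inl (j, r)) => j + 1 + r
    | .inr (.inr j) => j + 1 + 3
  card_opn i x h := by
    rcases i with j | ⟨j, r⟩ | j
    · simp; omega
    · exact Finset.card_pair (by simp [Prod.ext_iff]; omega)
    · simp
  card_cls i x h := by
    rcases i with j | ⟨j, r⟩ | j
    · simp
    · simp only
      rw [Finset.card_union_of_disjoint, card_vseg, card_vseg]
      · omega
      · exact Finset.disjoint_left.2 fun z hz hz' => by simp only [mem_vseg] at hz hz'; omega
    · simp only
      rw [Finset.card_union_of_disjoint, card_vseg, card_vseg]
      · omega
      · exact Finset.disjoint_left.2 fun z hz hz' => by simp only [mem_vseg] at hz hz'; omega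
  disjoint i x h := by
    rw [Finset.disjoint_left]
    rintro ⟨z₁, z₂⟩ hz hz'
    rcases i with j | ⟨j, r⟩ | j <;>
      simp only [mem_vseg, Finset.mem_insert, Finset.mem_singleton, Finset.mem_union,
        Prod.mk.injEq] at hz hz' <;> omega
  mem_opn i x h := by
    rintro ⟨z₁, z₂⟩ hz
    rcases i with j | ⟨j, r⟩ | j <;>
      simp only [mem_vseg, Finset.mem_insert, Finset.mem_singleton, Prod.mk.injEq] at hz <;> omega
  mem_cls i x h := by
    rintro ⟨z₁, z₂⟩ hz
    rcases i with j | ⟨j, r⟩ | j <;>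
      simp only [mem_vseg, Finset.mem_singleton, Finset.mem_union, Prod.mk.injEq] at hz <;> omega

/-- The refined local events that start from the special state, in which the site three below the
current level cannot be entered from the preceding column. -/
noncomputable def specialFamily : StepFamily Bool (RefinedIndex true) where
  opn i x h := match i with
    | .inl j => vseg x h (h + j)
    -- For `j = 2` the first open site is at `h - 3`, the level that cannot be entered from the
    -- left. The case is split by the site `h - 4`: if it is closed, the last index applies, with
    -- displacement -4.
    | .inr (.inl j) => if j = 2 then {(x, h - 3), (x, h - 4)} else {(x, h - j - 1)}
    | .inr (.inr _) => {(x, h - 3)}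
  cls i x h := match i with
    | .inl j => {(x, h + j + 1)}
    | .inr (.inl j) => vseg x (h - j) h
    | .inr (.inr _) => insert (x, h - 4) (vseg x (h - 2) h)
  disp i := match i with
    | .inl j => j + 1
    | .inr (.inl j) => -j
    | .inr (.inr _) => -4
  next _ := false
  numOpn i := match i with
    | .inl j => j + 1
    | .inr (.inl j) => if j = 2 then 2 else 1
    | .inr (.inr _) => 1
  numCls i := match i with
    | .inl _ => 1
    | .inr (.inl j) => j + 1
    | .inr (.inr _) => 4
  card_opn i x h := by
    rcases i with j | j | j
    · simp; omega
    · by_cases hj : j = 2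
      · simp only [hj, if_true]
        exact Finset.card_pair (by simp)
      · simp [hj]
    · simp
  card_cls i x h := by
    rcases i with j | j | j
    · simp
    · simp; omega
    · simp only
      rw [Finset.card_insert_of_notMem (by simp; omega), card_vseg]
      omega
  disjoint i x h := by
    rw [Finset.disjoint_left]
    rintro ⟨z₁, z₂⟩ hz hz'
    rcases i with j | j | j
    · simp only [mem_vseg, Finset.mem_singleton, Prod.mk.injEq] at hz hz'
      omega
    · by_cases hj : j = 2 <;>
        simp only [hj, if_true, if_false, mem_vseg, Finset.mem_insert, Finset.mem_singleton,
          Prod.mk.injEq] at hz hz' <;> omega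
    · simp only [mem_vseg, Finset.mem_insert, Finset.mem_singleton, Prod.mk.injEq] at hz hz'
      omega
  mem_opn i x h := by
    rintro ⟨z₁, z₂⟩ hz
    rcases i with j | j | j
    · simp only [mem_vseg] at hz
      exact hz.1
    · by_cases hj : j = 2 <;>
        simp only [hj, if_true, if_false, Finset.mem_insert, Finset.mem_singleton,
          Prod.mk.injEq] at hz <;> omega
    · simp only [Finset.mem_singleton, Prod.mk.injEq] at hz
      exact hz.1
  mem_cls i x h := by
    rintro ⟨z₁, z₂⟩ hz
    rcases i with j | j | j <;>
      simp only [mem_vseg, Finset.mem_insert, Finset.mem_singleton, Prod.mk.injEq] at hz <;> omega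

/-- The refined local events. -/
noncomputable def refinedFamily : ∀ s, StepFamily Bool (RefinedIndex s)
  | false => normalFamily
  | true => specialFamily

theorem hasSum_normalFamily {p q t : ℝ} (hp : 0 ≤ p) (hq : 0 ≤ q) (ht : 0 < t) (hqt : q * t < 1)
    (hpt : p < t) (κ : Bool → ℝ) :
    HasSum (fun i => q ^ normalFamily.numOpn i * p ^ normalFamily.numCls i *
        t ^ normalFamily.disp i * κ (normalFamily.next i))
      (p * q * t / (1 - q * t) * κ false + (p * q * t / (t - p) * (q * (1 + p + p ^ 2)) * κ false +
        p * q * t / (t - p) * (p ^ 3 * κ true))) := by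
  refine HasSum.sum ?_ (HasSum.sum ?_ ?_)
  · exact ((hasSum_up hq ht hqt).mul_right (κ false)).congr_fun fun _ => rfl
  · have h3 : HasSum (fun r : Fin 3 => q * p ^ (r : ℕ)) (q * (1 + p + p ^ 2)) := by
      have := hasSum_fintype fun r : Fin 3 => q * p ^ (r : ℕ)
      convert! this using 1
      simp [Fin.sum_univ_three, mul_add]
    have h2 := hasSum_down (q := q) hp ht hpt
    refine ((h2.mul h3 (h2.summable.mul_of_nonneg h3.summable (fun j => ?_) fun r => ?_)).mul_right
      (κ false)).congr_fun fun i => ?_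
    · simp only [Pi.zero_apply]
      positivity
    · simp only [Pi.zero_apply]
      positivity
    · simp only [normalFamily, Function.comp]
      ring
  · refine ((hasSum_down (q := q) hp ht hpt).mul_right (p ^ 3 * κ true)).congr_fun fun i => ?_
    simp only [normalFamily, Function.comp]
    ring

/-- Compared with `edgeFamily`, a portion p^4 q of the weight moves from displacement -2 to
displacement -4, which is the subtracted term. -/
theorem hasSum_specialFamily {p q t : ℝ} (hpq : p = 1 - q) (hp : 0 ≤ p) (hq : 0 ≤ q) (ht : 0 < t)
    (hqt : q * t < 1) (hpt : p < t) (κ : Bool → ℝ) :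
    HasSum (fun i => q ^ specialFamily.numOpn i * p ^ specialFamily.numCls i *
        t ^ specialFamily.disp i * κ (specialFamily.next i))
      ((p * q * t / (1 - q * t) + p * q * t / (t - p) - p ^ 4 * q * (1 / t ^ 2 - 1 / t ^ 4)) *
        κ false) := by
  have h1 : HasSum (fun j : ℕ => q ^ (if j = 2 then 2 else 1) * p ^ (j + 1) * t ^ (-(j : ℤ)))
      (p * q * t / (t - p) + -(p ^ 4 * q / t ^ 2)) := by
    refine ((hasSum_down (q := q) hp ht hpt).add
      (hasSum_ite_eq 2 (-(p ^ 4 * q / t ^ 2)))).congr_fun fun j => ?_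
    by_cases hj : j = 2
    · subst hj
      have : q ^ 2 = q * (1 - p) := by rw [hpq]; ring
      simp only [if_true, this, Nat.cast_ofNat, zpow_neg]
      norm_cast
      field_simp
      ring
    · simp [hj]
  have h2 : HasSum (fun _ : Unit => q ^ 1 * p ^ 4 * t ^ (-4 : ℤ)) (p ^ 4 * q / t ^ 4) := by
    have := hasSum_fintype fun _ : Unit => q ^ 1 * p ^ 4 * t ^ (-4 : ℤ)
    convert! this using 1
    simp only [Finset.univ_unique, Finset.sum_const, Finset.card_singleton, one_smul, zpow_neg]
    norm_cast
    field_simp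
  have h3 := HasSum.sum (f := fun i => q ^ specialFamily.numOpn i * p ^ specialFamily.numCls i *
        t ^ specialFamily.disp i * κ (specialFamily.next i))
    (((hasSum_up (p := p) hq ht hqt).mul_right (κ false)).congr_fun fun _ => rfl)
    (HasSum.sum ((h1.mul_right (κ false)).congr_fun fun _ => rfl)
      ((h2.mul_right (κ false)).congr_fun fun _ => rfl))
  convert! h3 using 1
  field_simp
  ring

/-- Below `0.4311`, the drift of the refined events is negative. -/
theorem refined_drift_neg {p q : ℝ} (hpq : p = 1 - q) (hq : 0 < q) (h : q < 0.4311) :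
    (q ^ 2 - p ^ 3) * (1 + p ^ 4) < 2 * p ^ 9 * q ^ 2 := by
  have hp : (0.5689 : ℝ) < p := by rw [hpq]; linarith
  have hp0 : 0 < p := by linarith
  have hp1 : p < 1 := by linarith
  have hr : 0 < 2 * p ^ 9 * q ^ 2 := by positivity
  -- Up to 0.43 the unrefined criterion q^2 ≤ p^3 already holds; on the short remaining interval
  -- crude endpoint bounds suffice.
  rcases le_or_gt q 0.43 with hq' | hq'
  · refine lt_of_le_of_lt (mul_nonpos_of_nonpos_of_nonneg ?_ (by positivity)) hr
    have h1 : q ^ 2 ≤ 0.43 ^ 2 := by gcongr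
    have h2 : (0.57 : ℝ) ^ 3 ≤ p ^ 3 := by gcongr; rw [hpq]; linarith
    linarith [show (0.43 : ℝ) ^ 2 ≤ 0.57 ^ 3 by norm_num]
  · have h1 : q ^ 2 ≤ 0.4311 ^ 2 := by gcongr
    have h2 : (0.5689 : ℝ) ^ 3 ≤ p ^ 3 := by gcongr
    have h3 : p ^ 4 ≤ 0.57 ^ 4 := by gcongr; rw [hpq]; linarith
    have h4 : (0.5689 : ℝ) ^ 9 ≤ p ^ 9 := by gcongr
    have h5 : (0.43 : ℝ) ^ 2 ≤ q ^ 2 := by gcongr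
    calc (q ^ 2 - p ^ 3) * (1 + p ^ 4) ≤ (0.4311 ^ 2 - 0.5689 ^ 3) * (1 + 0.57 ^ 4) := by
          refine mul_le_mul (by linarith) (by linarith) (by positivity) (by norm_num)
      _ < 2 * 0.5689 ^ 9 * 0.43 ^ 2 := by norm_num
      _ ≤ 2 * p ^ 9 * q ^ 2 := by gcongr

theorem hasDerivAt_correction (p q : ℝ) :
    HasDerivAt (fun t : ℝ => p ^ 4 * q * (1 / t ^ 2 - 1 / t ^ 4)) (2 * p ^ 4 * q) 1 := by
  have h1 : HasDerivAt (fun t : ℝ => 1 / t ^ 2) (-2) 1 := by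
    exact ((hasDerivAt_const (1 : ℝ) (1 : ℝ)).div (hasDerivAt_pow 2 (1 : ℝ))
      (by norm_num)).congr_deriv (by norm_num)
  have h2 : HasDerivAt (fun t : ℝ => 1 / t ^ 4) (-4) 1 := by
    exact ((hasDerivAt_const (1 : ℝ) (1 : ℝ)).div (hasDerivAt_pow 4 (1 : ℝ))
      (by norm_num)).congr_deriv (by norm_num)
  exact ((h1.sub h2).const_mul (p ^ 4 * q)).congr_deriv (by ring)

/-- The left side is the moment of a full cycle: a step from the normal state, followed by a special
step when the special state is entered. It equals 1 at t = 1, and its derivative there has the sign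
treated in `refined_drift_neg`. -/
theorem exists_refined_moment_lt_one {p q : ℝ} (hpq : p = 1 - q) (hq : 0 ≤ q) (h : q < 0.4311) :
    ∃ t, 1 < t ∧ q * t < 1 ∧
      p * q * t / (1 - q * t) + p * q * t / (t - p) * (q * (1 + p + p ^ 2)) +
        p * q * t / (t - p) * (p ^ 3 * (p * q * t / (1 - q * t) + p * q * t / (t - p) -
          p ^ 4 * q * (1 / t ^ 2 - 1 / t ^ 4))) < 1 := by
  rcases hq.eq_or_lt with rfl | hq0
  · exact ⟨2, by norm_num⟩
  have hp : 0 < p := by rw [hpq]; linarith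
  have hU := hasDerivAt_up hpq hp.ne'
  have hA := hasDerivAt_down hpq hq0.ne'
  have e1 : 1 - q * 1 = p := by rw [hpq]; ring
  have e2 : 1 - p = q := by rw [hpq]; ring
  have vU : p * q * 1 / (1 - q * 1) = q := by rw [e1]; field_simp
  have vA : p * q * 1 / (1 - p) = p := by rw [e2]; field_simp
  have hd := (hU.add (hA.mul_const (q * (1 + p + p ^ 2)))).add
    (hA.mul (((hU.add hA).sub (hasDerivAt_correction p q)).const_mul (p ^ 3)))
  have hneg : q / p + -(p ^ 2 / q) * (q * (1 + p + p ^ 2)) +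
      (-(p ^ 2 / q) * (p ^ 3 * (p * q * 1 / (1 - q * 1) + p * q * 1 / (1 - p) -
        p ^ 4 * q * (1 / 1 ^ 2 - 1 / 1 ^ 4))) + p * q * 1 / (1 - p) *
        (p ^ 3 * (q / p + -(p ^ 2 / q) - 2 * p ^ 4 * q))) < 0 := by
    rw [vU, vA]
    have e3 : q * (1 + p + p ^ 2) = 1 - p ^ 3 := by rw [← e2]; ring
    have e4 : q + p - p ^ 4 * q * (1 / 1 ^ 2 - 1 / 1 ^ 4) = 1 := by rw [hpq]; ring
    rw [e3, e4]
    have := refined_drift_neg hpq hq0 h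
    have e5 : q / p + -(p ^ 2 / q) * (1 - p ^ 3) + (-(p ^ 2 / q) * (p ^ 3 * 1) +
        p * (p ^ 3 * (q / p + -(p ^ 2 / q) - 2 * p ^ 4 * q))) =
        ((q ^ 2 - p ^ 3) * (1 + p ^ 4) - 2 * p ^ 9 * q ^ 2) / (p * q) := by
      field_simp
      ring
    rw [e5]
    exact div_neg_of_neg_of_pos (by linarith) (by positivity)
  obtain ⟨t, h1, h2, h3⟩ := exists_gt_lt_of_hasDerivAt_neg hd hneg
    (show (1 : ℝ) < 1 / q from by rw [lt_div_iff₀ hq0]; linarith)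
  refine ⟨t, h1, ?_, h3.trans_le (le_of_eq ?_)⟩
  · rw [lt_div_iff₀ hq0] at h2
    linarith
  · simp only [Pi.add_apply, Pi.mul_apply, Pi.sub_apply]
    rw [vU, vA, hpq]
    ring

/-- Below `0.4311`, the probability that the refined local events lead back to a nonnegative level
decays exponentially. -/
theorem exists_measure_reach_refinedFamily_le {q : ℝ} (hq : 0 ≤ q) (h : q < 0.4311) :
    ∃ C M : ℝ, 0 ≤ C ∧ 0 ≤ M ∧ M < 1 ∧ ∀ {Ω : Type} [MeasurableSpace Ω] {μ : Measure Ω}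
      {o c : ℤ × ℤ → Set Ω}, IsSiteField μ o c (ENNReal.ofReal q) (ENNReal.ofReal (1 - q)) →
      ∀ n, μ {ω | StepFamily.Reach refinedFamily o c (fun y => 0 ≤ y) n false 0 0 ω} ≤
        ENNReal.ofReal (C * M ^ n) := by
  obtain ⟨p, hpq⟩ : ∃ p, p = 1 - q := ⟨_, rfl⟩
  rw [← hpq]
  obtain ⟨t, ht1, hqt, hT⟩ := exists_refined_moment_lt_one hpq hq h
  have hp : 0 < p := by rw [hpq]; linarith
  have ht : 0 < t := by linarith
  have hpt : p < t := by linarith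
  set U := p * q * t / (1 - q * t) with hU
  set A := p * q * t / (t - p) with hA
  set N := U + A - p ^ 4 * q * (1 / t ^ 2 - 1 / t ^ 4) with hN
  have hsB := fun κ => hasSum_specialFamily hpq hp.le hq ht hqt hpt κ
  have hU0 : 0 ≤ U := div_nonneg (by positivity) (by linarith)
  have hA0 : 0 ≤ A := div_nonneg (by positivity) (by linarith)
  have hN0 : 0 ≤ N := by
    have : 0 ≤ N * 1 := (hsB fun _ => 1).nonneg fun i => by positivity
    simpa only [mul_one] using this
  -- `N` is enlarged slightly to have a positive number to divide by; for q = 0 it vanishes.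
  obtain ⟨N', hN', hT'⟩ : ∃ N', N < N' ∧ U + A * (q * (1 + p + p ^ 2)) + A * (p ^ 3 * N') < 1 := by
    have hcont : Filter.Tendsto (fun N' => U + A * (q * (1 + p + p ^ 2)) + A * (p ^ 3 * N'))
        (nhdsWithin N (Set.Ioi N)) (nhds (U + A * (q * (1 + p + p ^ 2)) + A * (p ^ 3 * N))) :=
      (Continuous.tendsto (by fun_prop) N).mono_left nhdsWithin_le_nhds
    obtain ⟨N', h1, h2⟩ := ((hcont.eventually_lt_const hT).and self_mem_nhdsWithin).exists
    exact ⟨N', h2, h1⟩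
  have hN'0 : 0 < N' := hN0.trans_lt hN'
  set T := U + A * (q * (1 + p + p ^ 2)) + A * (p ^ 3 * N') with hTdef
  have hT0 : 0 ≤ T := by positivity
  -- The cycle bound `T` covers up to two steps, so the rate per step should be at least the square
  -- root of `T`; the arithmetic mean of 1 and `T` is such a rate and is below 1.
  set M := (1 + T) / 2 with hM
  have hM0 : 0 < M := by positivity
  have hM1 : M < 1 := by rw [hM]; linarith
  have hMT : T ≤ M * M := by rw [hM]; nlinarith [sq_nonneg (1 - T)]
  set C := 1 + M / N' with hC
  have hC1 : 1 ≤ C := by rw [hC]; linarith [show 0 ≤ M / N' by positivity]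
  have hκ1 : C * N' / M = N' / M + 1 := by rw [hC]; field_simp
  have hκ0 : 1 ≤ C * N' / M := by rw [hκ1]; linarith [show 0 ≤ N' / M by positivity]
  -- An approximate eigenvector of the transfer matrix with entries α, β in the normal row and `N`,
  -- 0 in the special row, where α + β N < 1. The scale `C` makes both entries at least 1.
  let κ : Bool → ℝ := fun s => bif s then C * N' / M else C
  have hκ : ∀ s, 1 ≤ κ s := by
    intro s
    cases s
    · exact hC1
    · exact hκ0
  refine ⟨C, M, by linarith, hM0.le, hM1, fun {Ω} _ {μ} {o c} H n => ?_⟩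
  have := StepFamily.measure_reach_le refinedFamily hq hp.le ht hM0.le H (κ := κ)
    (T := fun s => bif s then N * C else U * C + (A * (q * (1 + p + p ^ 2)) * C +
      A * (p ^ 3 * (C * N' / M)))) (fun s => by linarith [hκ s]) ?_ ?_
    (Q := fun y => 0 ≤ y) 0 ?_ n false 0 0
  · simpa [κ, mul_comm] using this
  · intro s
    cases s
    · exact hasSum_normalFamily hp.le hq ht hqt hpt κ
    · exact hsB κ
  · intro s
    cases s
    · show U * C + (A * (q * (1 + p + p ^ 2)) * C + A * (p ^ 3 * (C * N' / M))) ≤ M * C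
      have e1 : A * (p ^ 3 * (C * N' / M)) = C * (A * (p ^ 3 * N')) / M := by ring
      have h1 : U + A * (q * (1 + p + p ^ 2)) ≤ (U + A * (q * (1 + p + p ^ 2))) / M :=
        le_div_self (by positivity) hM0 hM1.le
      have h2 : T / M ≤ M := by rwa [div_le_iff₀ hM0]
      calc _ = C * (U + A * (q * (1 + p + p ^ 2))) + C * (A * (p ^ 3 * N') / M) := by ring
        _ ≤ C * ((U + A * (q * (1 + p + p ^ 2))) / M) + C * (A * (p ^ 3 * N') / M) := by gcongr
        _ = C * (T / M) := by rw [hTdef]; ring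
        _ ≤ C * M := by gcongr
        _ = M * C := mul_comm _ _
    · show N * C ≤ M * (C * N' / M)
      rw [mul_div_cancel₀ _ hM0.ne', mul_comm]
      gcongr
  · intro s h hh
    rw [sub_zero]
    exact one_le_mul_of_one_le_of_one_le (hκ s) (one_le_zpow₀ ht1.le hh)
-- Geometry of the five-neighbour cluster
/-- The moves of five-neighbour oriented site percolation, with the horizontal axis reflected. -/
def FiveStep (op : ℤ × ℤ → Prop) (u v : ℤ × ℤ) : Prop :=
  op u ∧ ((v.1 = u.1 ∧ (v.2 = u.2 + 1 ∨ v.2 = u.2 - 1)) ∨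
    (v.1 = u.1 + 1 ∧ u.2 - 1 ≤ v.2 ∧ v.2 ≤ u.2 + 1))

/-- The site `v` belongs to the cluster of the origin. -/
def Reached (op : ℤ × ℤ → Prop) (v : ℤ × ℤ) : Prop :=
  Relation.ReflTransGen (FiveStep op) (0, 0) v

/-- The column `x` can be entered at level `y` by the cluster of the origin. -/
def Entry (op : ℤ × ℤ → Prop) (x y : ℤ) : Prop :=
  (x = 0 ∧ y = 0) ∨ ∃ y', Reached op (x - 1, y') ∧ op (x - 1, y') ∧ y' - 1 ≤ y ∧ y ≤ y' + 1

section
variable {op : ℤ × ℤ → Prop}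

theorem Reached.nonneg {v : ℤ × ℤ} (h : Reached op v) : 0 ≤ v.1 := by
  induction h with
  | refl => exact le_rfl
  | tail _ hs ih => rcases hs.2 with h | h <;> omega

/-- Columns are never re-entered, and a vertical move requires the site left behind to be open. So
all sites from the entry to `v` are open, except possibly `v` itself. -/
theorem Reached.exists_entry {v : ℤ × ℤ} (h : Reached op v) :
    ∃ e, Entry op v.1 e ∧ ∀ y, (e ≤ y ∧ y < v.2 ∨ v.2 < y ∧ y ≤ e) → op (v.1, y) := by
  induction h with
  | refl => exact ⟨0, Or.inl ⟨rfl, rfl⟩, fun y hy => by simp only at hy; omega⟩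
  | @tail u v hu hs ih =>
    obtain ⟨hop, hs⟩ := hs
    rcases hs with ⟨h1, h2⟩ | ⟨h1, h2, h3⟩
    · obtain ⟨e, he, hrun⟩ := ih
      rw [h1]
      refine ⟨e, he, fun y hy => ?_⟩
      by_cases hy' : y = u.2
      · rw [hy']; exact hop
      · exact hrun y (by omega)
    · refine ⟨v.2, Or.inr ⟨u.2, ?_, ?_, by omega, by omega⟩, fun y hy => by omega⟩
      · rw [h1, add_sub_cancel_right]; exact hu
      · rw [h1, add_sub_cancel_right]; exact hop

theorem Reached.exists_open {v : ℤ × ℤ} (h : Reached op v) :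
    ∀ x, 0 ≤ x → x < v.1 → ∃ y, Reached op (x, y) ∧ op (x, y) := by
  induction h with
  | refl => exact fun x h0 h1 => absurd h1 (not_lt.2 h0)
  | @tail u v hu hs ih =>
    intro x h0 h1
    rcases lt_or_ge x u.1 with hx | hx
    · exact ih x h0 hx
    · have : x = u.1 := by rcases hs.2 with h | h <;> omega
      subst this
      exact ⟨u.2, hu, hs.1⟩

theorem Reached.reflect {v : ℤ × ℤ} (h : Reached op v) :
    Reached (fun z => op (z.1, -z.2)) (v.1, -v.2) := by
  refine Relation.ReflTransGen.lift (fun z : ℤ × ℤ => (z.1, -z.2)) (fun u v huv => ?_) _ _ h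
  refine ⟨by simpa using huv.1, ?_⟩
  have := huv.2
  simp only
  omega

theorem Entry.reflect {x y : ℤ} (h : Entry op x y) : Entry (fun z => op (z.1, -z.2)) x (-y) := by
  rcases h with ⟨h0, h1⟩ | ⟨y', h1, h2, h3, h4⟩
  · exact Or.inl ⟨h0, by rw [h1, neg_zero]⟩
  · exact Or.inr ⟨-y', h1.reflect, by simpa using h2, by omega, by omega⟩

/-- The control on the entries to column `x` that is maintained by the refined local events. -/
def EntryBound (op : ℤ × ℤ → Prop) (s : Bool) (x h : ℤ) : Prop :=
  (∀ y, Entry op x y → y ≤ h) ∧ (s = true → ¬ Entry op x (h - 3))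

theorem entryBound_false_succ {x h : ℤ} (hx : 0 ≤ x)
    (H : ∀ y, Reached op (x, y) → op (x, y) → y < h) : EntryBound op false (x + 1) h := by
  refine ⟨?_, fun h => by simp at h⟩
  rintro y (⟨h0, -⟩ | ⟨y', h1, h2, h3, h4⟩)
  · omega
  · rw [add_sub_cancel_right] at h1 h2
    have := H y' h1 h2
    omega

/-- All entries are at or below `h ≤ k`, so a reached open site at or above `k` would require the
closed site `k` to be open. -/
theorem EntryBound.lt_of_run {s : Bool} {x h k : ℤ} (hb : EntryBound op s x h) (hk : h ≤ k)
    (hcl : ¬ op (x, k)) {y : ℤ} (hr : Reached op (x, y)) (ho : op (x, y)) : y < k := by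
  obtain ⟨e, he, hrun⟩ := hr.exists_entry
  have := hb.1 e he
  by_contra! hky
  rcases hky.eq_or_lt with rfl | hlt
  · exact hcl ho
  · exact hcl (hrun k (Or.inl ⟨by omega, hlt⟩))

variable {Ω : Type*} {o c : ℤ × ℤ → Set Ω} {ω : Ω}

theorem exists_occurs_normalFamily (hoc : ∀ z, ω ∈ c z ↔ ω ∉ o z)
    (hcl : ∀ x h, ∃ y, h ≤ y ∧ ω ∉ o (x, y)) {x h : ℤ} (hx : 0 ≤ x)
    (hb : EntryBound (fun z => ω ∈ o z) false x h)
    (hne : ∃ y, Reached (fun z => ω ∈ o z) (x, y) ∧ ω ∈ o (x, y)) :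
    ∃ i, normalFamily.Occurs o c i x h ω ∧
      EntryBound (fun z => ω ∈ o z) (normalFamily.next i) (x + 1) (h + normalFamily.disp i) := by
  by_cases hop : ω ∈ o (x, h)
  · obtain ⟨k, ⟨hk, hkc⟩, hmin⟩ := Int.exists_least_of_bdd (P := fun y => h ≤ y ∧ ω ∉ o (x, y))
      ⟨h, fun z hz => hz.1⟩ (hcl x h)
    have hkh : k ≠ h := by rintro rfl; exact hkc hop
    have e : h + ((k - h - 1).toNat : ℤ) + 1 = k := by omega
    refine ⟨.inl (k - h - 1).toNat, ⟨?_, ?_⟩, ?_⟩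
    · rintro ⟨z₁, z₂⟩ hz
      simp only [normalFamily, mem_vseg] at hz
      obtain ⟨rfl, hz, hz'⟩ := hz
      by_contra hno
      have := hmin z₂ ⟨hz, hno⟩
      omega
    · intro z hz
      simp only [normalFamily, e, Finset.mem_singleton] at hz
      subst hz
      exact (hoc _).2 hkc
    · simp only [normalFamily]
      rw [← add_assoc, e]
      exact entryBound_false_succ hx fun y hr ho => hb.lt_of_run hk hkc hr ho
  · obtain ⟨y₀, hr₀, ho₀⟩ := hne
    have hlt₀ := hb.lt_of_run le_rfl hop hr₀ ho₀
    obtain ⟨k, ⟨hk, hko⟩, hmax⟩ := Int.exists_greatest_of_bdd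
      (P := fun y => y ≤ h ∧ ω ∈ o (x, y)) ⟨h, fun z hz => hz.1⟩ ⟨y₀, hlt₀.le, ho₀⟩
    have hkh : k ≠ h := by rintro rfl; exact hop hko
    have hrun : ∀ z, k < z → z ≤ h → ω ∈ c (x, z) := fun z hz hz' => (hoc _).2 fun hno =>
      absurd (hmax z ⟨hz', hno⟩) (by omega)
    have htop : ∀ y, Reached (fun z => ω ∈ o z) (x, y) → ω ∈ o (x, y) → y ≤ k := fun y hr ho =>
      hmax y ⟨(hb.lt_of_run le_rfl hop hr ho).le, ho⟩
    have e : h + -((h - k - 1).toNat : ℤ) = k + 1 := by omega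
    have e' : h - ((h - k - 1).toNat : ℤ) = k + 1 := by omega
    by_cases hall : ∃ r : Fin 3, ω ∈ o (x, k - 1 - (r : ℕ)) ∧ ∀ z, k - 1 - (r : ℕ) < z → z < k →
        ω ∈ c (x, z)
    · obtain ⟨r, hr, hr'⟩ := hall
      refine ⟨.inr (.inl ((h - k - 1).toNat, r)), ⟨?_, ?_⟩, ?_⟩
      · rintro ⟨z₁, z₂⟩ hz
        simp only [normalFamily, e', Finset.mem_insert, Finset.mem_singleton, Prod.mk.injEq] at hz
        rcases hz with ⟨rfl, hz⟩ | ⟨rfl, hz⟩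
        · rwa [hz, add_sub_cancel_right]
        · rwa [hz, show k + 1 - 2 - ((r : ℕ) : ℤ) = k - 1 - (r : ℕ) by ring]
      · rintro ⟨z₁, z₂⟩ hz
        simp only [normalFamily, e', mem_vseg, Finset.mem_union] at hz
        rcases hz with ⟨rfl, hz, hz'⟩ | ⟨rfl, hz, hz'⟩
        · exact hrun _ (by omega) hz'
        · exact hr' _ (by omega) (by omega)
      · simp only [normalFamily, e]
        exact entryBound_false_succ hx fun y hr ho => by have := htop y hr ho; omega
    · have hc1 : ω ∈ c (x, k - 1) := (hoc _).2 fun hno =>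
        hall ⟨0, by simpa using hno, fun z hz hz' => by simp at hz; omega⟩
      have hc2 : ω ∈ c (x, k - 2) := (hoc _).2 fun hno =>
        hall ⟨1, by simpa [sub_sub] using hno, fun z hz hz' => by
          simp at hz
          rwa [show z = k - 1 by omega]⟩
      have hc3 : ω ∈ c (x, k - 3) := (hoc _).2 fun hno =>
        hall ⟨2, by simpa [sub_sub] using hno, fun z hz hz' => by
          simp at hz
          obtain rfl | rfl : z = k - 1 ∨ z = k - 2 := by omega
          · exact hc1
          · exact hc2⟩
      refine ⟨.inr (.inr (h - k - 1).toNat), ⟨?_, ?_⟩, ?_⟩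
      · rintro ⟨z₁, z₂⟩ hz
        simp only [normalFamily, e', Finset.mem_singleton, Prod.mk.injEq] at hz
        rwa [hz.1, hz.2, add_sub_cancel_right]
      · rintro ⟨z₁, z₂⟩ hz
        simp only [normalFamily, e', mem_vseg, Finset.mem_union] at hz
        rcases hz with ⟨rfl, hz, hz'⟩ | ⟨rfl, hz, hz'⟩
        · exact hrun _ (by omega) hz'
        · obtain rfl | rfl | rfl : z₂ = k - 1 ∨ z₂ = k - 2 ∨ z₂ = k - 3 := by omega
          · exact hc1
          · exact hc2
          · exact hc3
      · simp only [normalFamily, e]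
        refine ⟨(entryBound_false_succ hx fun y hr ho => by have := htop y hr ho; omega).1,
          fun _ => ?_⟩
        -- The new level is `k + 1`, so the forbidden entry is at `k - 2`; its possible sources `k -
        -- 1`, `k - 2`, `k - 3` are all closed.
        rintro (⟨h0, -⟩ | ⟨y', h1, h2, h3, h4⟩)
        · omega
        · rw [add_sub_cancel_right] at h1 h2
          obtain rfl | rfl | rfl : y' = k - 1 ∨ y' = k - 2 ∨ y' = k - 3 := by omega
          · exact (hoc _).1 hc1 h2
          · exact (hoc _).1 hc2 h2
          · exact (hoc _).1 hc3 h2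

theorem exists_occurs_specialFamily (hoc : ∀ z, ω ∈ c z ↔ ω ∉ o z)
    (hcl : ∀ x h, ∃ y, h ≤ y ∧ ω ∉ o (x, y)) {x h : ℤ} (hx : 0 ≤ x)
    (hb : EntryBound (fun z => ω ∈ o z) true x h)
    (hne : ∃ y, Reached (fun z => ω ∈ o z) (x, y) ∧ ω ∈ o (x, y)) :
    ∃ i, specialFamily.Occurs o c i x h ω ∧
      EntryBound (fun z => ω ∈ o z) (specialFamily.next i) (x + 1)
        (h + specialFamily.disp i) := by
  by_cases hop : ω ∈ o (x, h)
  · obtain ⟨k, ⟨hk, hkc⟩, hmin⟩ := Int.exists_least_of_bdd (P := fun y => h ≤ y ∧ ω ∉ o (x, y))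
      ⟨h, fun z hz => hz.1⟩ (hcl x h)
    have hkh : k ≠ h := by rintro rfl; exact hkc hop
    have e : h + ((k - h - 1).toNat : ℤ) + 1 = k := by omega
    refine ⟨.inl (k - h - 1).toNat, ⟨?_, ?_⟩, ?_⟩
    · rintro ⟨z₁, z₂⟩ hz
      simp only [specialFamily, mem_vseg] at hz
      obtain ⟨rfl, hz, hz'⟩ := hz
      by_contra hno
      have := hmin z₂ ⟨hz, hno⟩
      omega
    · intro z hz
      simp only [specialFamily, e, Finset.mem_singleton] at hz
      subst hz
      exact (hoc _).2 hkc
    · simp only [specialFamily]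
      rw [← add_assoc, e]
      exact entryBound_false_succ hx fun y hr ho => hb.lt_of_run hk hkc hr ho
  · obtain ⟨y₀, hr₀, ho₀⟩ := hne
    have hlt₀ := hb.lt_of_run le_rfl hop hr₀ ho₀
    obtain ⟨k, ⟨hk, hko⟩, hmax⟩ := Int.exists_greatest_of_bdd
      (P := fun y => y ≤ h ∧ ω ∈ o (x, y)) ⟨h, fun z hz => hz.1⟩ ⟨y₀, hlt₀.le, ho₀⟩
    have hkh : k ≠ h := by rintro rfl; exact hop hko
    have hrun : ∀ z, k < z → z ≤ h → ω ∈ c (x, z) := fun z hz hz' => (hoc _).2 fun hno =>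
      absurd (hmax z ⟨hz', hno⟩) (by omega)
    have htop : ∀ y, Reached (fun z => ω ∈ o z) (x, y) → ω ∈ o (x, y) → y ≤ k := fun y hr ho =>
      hmax y ⟨(hb.lt_of_run le_rfl hop hr ho).le, ho⟩
    have e : h + -((h - k - 1).toNat : ℤ) = k + 1 := by omega
    have e' : h - ((h - k - 1).toNat : ℤ) = k + 1 := by omega
    by_cases hexc : k = h - 3 ∧ ω ∉ o (x, h - 4)
    · obtain ⟨rfl, h4⟩ := hexc
      refine ⟨.inr (.inr ()), ⟨?_, ?_⟩, ?_⟩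
      · rintro ⟨z₁, z₂⟩ hz
        simp only [specialFamily, Finset.mem_singleton, Prod.mk.injEq] at hz
        rwa [hz.1, hz.2]
      · rintro ⟨z₁, z₂⟩ hz
        simp only [specialFamily, mem_vseg, Finset.mem_insert, Prod.mk.injEq] at hz
        rcases hz with ⟨rfl, rfl⟩ | ⟨rfl, hz, hz'⟩
        · exact (hoc _).2 h4
        · exact hrun _ (by omega) hz'
      · simp only [specialFamily]
        refine entryBound_false_succ hx fun y hr ho => ?_
        have hy := htop y hr ho
        by_contra! hlt
        -- The open site at `h - 3` is isolated: no entry there from the left, a closed site below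
        -- at `h - 4`, closed sites above up to `h`. The next possible level is `h - 5`, so the new
        -- bound is `h - 4`.
        obtain rfl | rfl : y = h - 3 ∨ y = h - 4 := by omega
        · obtain ⟨e, he, hrun'⟩ := hr.exists_entry
          have h1 := hb.1 e he
          have h2 : e ≠ h - 3 := by rintro rfl; exact hb.2 rfl he
          rcases lt_or_gt_of_ne h2 with h2 | h2
          · exact h4 (hrun' (h - 4) (Or.inl ⟨by omega, by simp⟩))
          · exact (hoc _).1 (hrun e h2 h1) (hrun' e (Or.inr ⟨h2, le_rfl⟩))
        · exact h4 ho
    · refine ⟨.inr (.inl (h - k - 1).toNat), ⟨?_, ?_⟩, ?_⟩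
      · rintro ⟨z₁, z₂⟩ hz
        by_cases hj : (h - k - 1).toNat = 2
        · have hk3 : k = h - 3 := by omega
          simp only [specialFamily, hj, if_true, Finset.mem_insert, Finset.mem_singleton,
            Prod.mk.injEq] at hz
          rcases hz with ⟨rfl, rfl⟩ | ⟨rfl, rfl⟩
          · rwa [← hk3]
          · by_contra hno
            exact hexc ⟨hk3, hno⟩
        · simp only [specialFamily, hj, if_false, e', Finset.mem_singleton, Prod.mk.injEq] at hz
          rwa [hz.1, hz.2, add_sub_cancel_right]
      · rintro ⟨z₁, z₂⟩ hz
        simp only [specialFamily, e', mem_vseg] at hz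
        obtain ⟨rfl, hz, hz'⟩ := hz
        exact hrun _ (by omega) hz'
      · simp only [specialFamily, e]
        exact entryBound_false_succ hx fun y hr ho => by have := htop y hr ho; omega

theorem exists_occurs_refinedFamily (hoc : ∀ z, ω ∈ c z ↔ ω ∉ o z)
    (hcl : ∀ x h, ∃ y, h ≤ y ∧ ω ∉ o (x, y)) (s : Bool) {x h : ℤ} (hx : 0 ≤ x)
    (hb : EntryBound (fun z => ω ∈ o z) s x h)
    (hne : ∃ y, Reached (fun z => ω ∈ o z) (x, y) ∧ ω ∈ o (x, y)) :
    ∃ i, (refinedFamily s).Occurs o c i x h ω ∧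
      EntryBound (fun z => ω ∈ o z) ((refinedFamily s).next i) (x + 1)
        (h + (refinedFamily s).disp i) := by
  cases s
  · exact exists_occurs_normalFamily hoc hcl hx hb hne
  · exact exists_occurs_specialFamily hoc hcl hx hb hne

/-- If the cluster enters column `N` at a nonnegative level, then the refined local events lead to
a nonnegative level. -/
theorem reach_of_entry (hoc : ∀ z, ω ∈ c z ↔ ω ∉ o z)
    (hcl : ∀ x h, ∃ y, h ≤ y ∧ ω ∉ o (x, y)) {N : ℕ} {y : ℤ} (hy : 0 ≤ y)
    (hent : Entry (fun z => ω ∈ o z) N y)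
    (hopen : ∀ x : ℤ, 0 ≤ x → x < N → ∃ y, Reached (fun z => ω ∈ o z) (x, y) ∧ ω ∈ o (x, y)) :
    StepFamily.Reach refinedFamily o c (fun y => 0 ≤ y) N false 0 0 ω := by
  have key : ∀ n k : ℕ, k + n = N → ∀ s h, EntryBound (fun z => ω ∈ o z) s k h →
      StepFamily.Reach refinedFamily o c (fun y => 0 ≤ y) n s k h ω := by
    intro n
    induction n with
    | zero =>
      intro k hk s h hb
      subst hk
      exact hy.trans (hb.1 y hent)
    | succ n ih =>
      intro k hk s h hb
      obtain ⟨i, hi, hb'⟩ := exists_occurs_refinedFamily hoc hcl s (by omega) hb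
        (hopen k (by omega) (by omega))
      exact ⟨i, hi, by simpa using ih (k + 1) (by omega) _ _ (by simpa using hb')⟩
  refine key N 0 (zero_add N) false 0 ⟨?_, fun h => by simp at h⟩
  rintro y (⟨-, rfl⟩ | ⟨y', h1, -⟩)
  · exact le_rfl
  · have := h1.nonneg
    simp at this

end

/-- If the open runs of all columns are finite, an infinite cluster meets all columns. -/
theorem exists_reached_column {op : ℤ × ℤ → Prop} (hcl : ∀ x h, ∃ y, h ≤ y ∧ ¬ op (x, y))
    (hcl' : ∀ x h, ∃ y, y ≤ h ∧ ¬ op (x, y)) (hinf : {v | Reached op v}.Infinite) (N : ℕ) :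
    ∃ v : ℤ × ℤ, Reached op v ∧ (N : ℤ) < v.1 := by
  by_contra! hN
  have hcol : ∀ n : ℕ, ∃ a b : ℤ, ∀ y, Reached op (n, y) → a ≤ y ∧ y ≤ b := by
    have step : ∀ (n a b : ℤ), (∀ y, Entry op n y → a ≤ y ∧ y ≤ b) →
        ∃ a b : ℤ, ∀ y, Reached op (n, y) → a ≤ y ∧ y ≤ b := by
      intro n a b hab
      obtain ⟨b', hb', hcb⟩ := hcl n b
      obtain ⟨a', ha', hca⟩ := hcl' n a
      refine ⟨a', b', fun y hy => ?_⟩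
      obtain ⟨e, he, hrun⟩ := hy.exists_entry
      have := hab e he
      constructor
      · by_contra! hlt
        exact hca (hrun a' (Or.inr ⟨hlt, by omega⟩))
      · by_contra! hlt
        exact hcb (hrun b' (Or.inl ⟨by omega, hlt⟩))
    intro n
    induction n with
    | zero =>
      refine step 0 0 0 ?_
      rintro y (⟨-, rfl⟩ | ⟨y', h1, -⟩)
      · exact ⟨le_rfl, le_rfl⟩
      · have := h1.nonneg
        simp at this
    | succ n ih =>
      obtain ⟨a, b, hab⟩ := ih
      refine step (n + 1 : ℕ) (a - 1) (b + 1) ?_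
      rintro y (⟨h0, -⟩ | ⟨y', h1, -, h3, h4⟩)
      · omega
      · have := hab y' (by simpa using h1)
        omega
  choose a b hab using hcol
  refine hinf (((Set.finite_Iic N).biUnion fun n _ =>
    (Set.finite_singleton (n : ℤ)).prod (Set.finite_Icc (a n) (b n))).subset ?_)
  rintro ⟨x, y⟩ hv
  have h0 : 0 ≤ x := Reached.nonneg hv
  have h1 : x ≤ N := hN _ hv
  obtain ⟨n, rfl⟩ := Int.eq_ofNat_of_zero_le h0
  simp only [Set.mem_iUnion]
  exact ⟨n, by simpa using h1, rfl, hab n y hv⟩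

/-! ### The lower bound for the critical value -/

theorem stepsFSOSP_ne_empty : stepsFSOSP ≠ ∅ := (Set.insert_nonempty _ _).ne_empty

theorem reached_of_connected {G : Env} (hG : ∀ z, G z = stepsFSOSP ∨ G z = ∅) {w : ℤ × ℤ}
    (h : Connected G (0, 0) w) :
    Reached (fun z => G (-z.1, z.2) = stepsFSOSP) (-w.1, w.2) := by
  refine Relation.ReflTransGen.lift (fun z : ℤ × ℤ => (-z.1, z.2)) (fun u v huv => ?_) _ _ h
  rcases hG u with hu | hu
  · refine ⟨by simpa using hu, ?_⟩
    rw [hu] at huv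
    simp only [stepsFSOSP, Set.mem_insert_iff, Set.mem_singleton_iff, Prod.ext_iff, Prod.fst_sub,
      Prod.snd_sub] at huv
    simp only
    omega
  · rw [hu] at huv
    exact absurd huv (Set.notMem_empty _)

theorem infinite_reached {G : Env} (hG : ∀ z, G z = stepsFSOSP ∨ G z = ∅)
    (h : (forwardCluster G (0, 0)).Infinite) :
    {v | Reached (fun z => G (-z.1, z.2) = stepsFSOSP) v}.Infinite := by
  have hinj : Function.Injective fun z : ℤ × ℤ => (-z.1, z.2) := by
    rintro ⟨a, b⟩ ⟨c, d⟩ h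
    simpa using h
  refine (h.image hinj.injOn).mono ?_
  rintro _ ⟨w, hw, rfl⟩
  exact reached_of_connected hG hw

/-- An infinite cluster enters column `N` at some level, which is either at least 0 or at most 0.
For large `N` the first is excluded by the exploration of the upper edge, the second by that of its
vertical reflection. -/
theorem ae_finite_forwardCluster {q : ℝ} (hq : 0 ≤ q) (h : q < 0.4311) :
    ∀ᵐ G ∂(envLaw stepsFSOSP ∅ q), ¬ (forwardCluster G (0, 0)).Infinite := by
  have hq1 : q < 1 := by linarith
  have H := isSiteField_envLaw stepsFSOSP_ne_empty hq hq1.le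
  have hlt : ENNReal.ofReal q < 1 := by simpa using hq1
  have hup : ∀ᵐ G ∂(envLaw stepsFSOSP ∅ q), ∀ x h : ℤ, ∃ n : ℕ, G (x, h + n) ≠ stepsFSOSP :=
    ae_all_iff.2 fun x => ae_all_iff.2 fun h =>
      H.swap.ae_exists_notMem hlt (f := fun n => (x, h + n)) fun m n h => by simpa using h
  have hdn : ∀ᵐ G ∂(envLaw stepsFSOSP ∅ q), ∀ x h : ℤ, ∃ n : ℕ, G (x, h - n) ≠ stepsFSOSP :=
    ae_all_iff.2 fun x => ae_all_iff.2 fun h =>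
      H.swap.ae_exists_notMem hlt (f := fun n => (x, h - n)) fun m n h => by simpa using h
  have H1 := H.comp (e := fun z => (-z.1, z.2)) fun ⟨a, b⟩ ⟨c, d⟩ h => by simpa using h
  have H2 := H.comp (e := fun z => (-z.1, -z.2)) fun ⟨a, b⟩ ⟨c, d⟩ h => by simpa using h
  obtain ⟨C, M, hC, hM0, hM1, hbound⟩ := exists_measure_reach_refinedFamily_le hq h
  filter_upwards [ae_eventually_notMem_of_le_geometric hC hM0 hM1 (hbound H1),
    ae_eventually_notMem_of_le_geometric hC hM0 hM1 (hbound H2), hup, hdn,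
    ae_envLaw_mem (A := stepsFSOSP) (B := ∅) hq hq1.le] with G h1 h2 hup hdn hG hinf
  obtain ⟨N, hN1, hN2⟩ := (h1.and h2).exists
  have hcl : ∀ x h, ∃ y, h ≤ y ∧ G (-x, y) ≠ stepsFSOSP := fun x h => by
    obtain ⟨n, hn⟩ := hup (-x) h
    exact ⟨h + n, by omega, hn⟩
  have hcl' : ∀ x h, ∃ y, y ≤ h ∧ G (-x, y) ≠ stepsFSOSP := fun x h => by
    obtain ⟨n, hn⟩ := hdn (-x) h
    exact ⟨h - n, by omega, hn⟩
  have hcl2 : ∀ x h, ∃ y, h ≤ y ∧ G (-x, -y) ≠ stepsFSOSP := fun x h => by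
    obtain ⟨n, hn⟩ := hdn (-x) (-h)
    exact ⟨h + n, by omega, by rwa [show -(h + (n : ℤ)) = -h - n by ring]⟩
  have hoc : ∀ z, G z = ∅ ↔ G z ≠ stepsFSOSP := fun z =>
    ⟨fun he hs => stepsFSOSP_ne_empty (hs.symm.trans he), fun hs => (hG z).resolve_left hs⟩
  obtain ⟨v, hv, hNv⟩ := exists_reached_column hcl hcl' (infinite_reached hG hinf) N
  have hopen : ∀ x : ℤ, 0 ≤ x → x < N → ∃ y,
      Reached (fun z => G (-z.1, z.2) = stepsFSOSP) (x, y) ∧ G (-x, y) = stepsFSOSP :=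
    fun x h0 h1 => hv.exists_open x h0 (h1.trans hNv)
  have hopen2 : ∀ x : ℤ, 0 ≤ x → x < N → ∃ y,
      Reached (fun z => G (-z.1, -z.2) = stepsFSOSP) (x, y) ∧ G (-x, -y) = stepsFSOSP := by
    intro x h0 h1
    obtain ⟨y, hy1, hy2⟩ := hopen x h0 h1
    exact ⟨-y, hy1.reflect, by simpa using hy2⟩
  obtain ⟨y, hy, -⟩ := hv.exists_open N (by omega) hNv
  obtain ⟨e, he, -⟩ := hy.exists_entry
  rcases le_total 0 e with h0 | h0
  · exact hN1 (reach_of_entry (fun z => hoc (-z.1, z.2)) hcl h0 he hopen)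
  · exact hN2 (reach_of_entry (fun z => hoc (-z.1, -z.2)) hcl2 (neg_nonneg.2 h0) he.reflect hopen2)

/-- Needed because the real infimum of the empty set is 0: the set defining `criticalFSOSP` must be
shown to be nonempty. -/
theorem measure_infinite_forwardCluster_one_pos :
    0 < envLaw stepsFSOSP ∅ 1 {G | (forwardCluster G (0, 0)).Infinite} := by
  have := isProbabilityMeasure_envLaw stepsFSOSP ∅ (p := 1) zero_le_one le_rfl
  have H := isSiteField_envLaw stepsFSOSP_ne_empty zero_le_one le_rfl
  have hopen : ∀ᵐ G ∂(envLaw stepsFSOSP ∅ 1), ∀ z, G z ≠ ∅ := ae_all_iff.2 fun z => by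
    rw [ae_iff]
    have := H ∅ {z} (by simp)
    simpa using this
  have hinf : ∀ᵐ G ∂(envLaw stepsFSOSP ∅ 1), (forwardCluster G (0, 0)).Infinite := by
    filter_upwards [hopen, ae_envLaw_mem (A := stepsFSOSP) (B := ∅) zero_le_one le_rfl] with G h1 h2
    refine Set.infinite_of_injective_forall_mem (f := fun n : ℕ => ((0 : ℤ), (n : ℤ)))
      (fun m n h => by simpa using h) fun n => ?_
    induction n with
    | zero => exact Connected.refl G _
    | succ n ih =>
      refine Connected.trans ih (connected_step ?_)
      rw [(h2 _).resolve_right (h1 _)]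
      simp [stepsFSOSP]
  rw [pos_iff_ne_zero]
  intro h0
  have hfin : ∀ᵐ G ∂(envLaw stepsFSOSP ∅ 1), ¬ (forwardCluster G (0, 0)).Infinite := by
    simpa [ae_iff] using h0
  obtain ⟨G, h1, h2⟩ := (hinf.and hfin).exists
  exact h2 h1

theorem le_criticalFSOSP : (0.4311 : ℝ) ≤ criticalFSOSP := by
  refine le_csInf ⟨1, zero_le_one, le_rfl, measure_infinite_forwardCluster_one_pos⟩ ?_
  rintro q ⟨h0, -, hpos⟩
  by_contra! hlt
  refine hpos.ne' ?_
  simpa [ae_iff] using ae_finite_forwardCluster h0 hlt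

end DRE

theorem theorem4p12 :
    (∀ p : ℝ, 0 < p ^ 3 - p ^ 2 + 2 * p - 1 → p < 1 →
      ∀ᵐ G ∂(DRE.envLaw DRE.stepsSWE DRE.stepsUp p), DRE.HasGiganticComponent G) ∧
    (0.4311 : ℝ) ≤ DRE.criticalFSOSP := by
  refine ⟨fun p h hp1 => DRE.ae_hasGiganticComponent ?_ hp1 (by linarith), DRE.le_criticalFSOSP⟩
  -- For p ≤ 0 the terms p^3, -p^2 and 2p are all nonpositive, so the polynomial is at most -1.
  by_contra! hp
  nlinarith [sq_nonneg p, pow_nonneg (neg_nonneg.2 hp) 3]
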